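/- Let $\omega$ denote the exponent of matrix multiplication over $\mathbb{Q}$, i.e. the infimum of the real numbers $\tau$ such that, for every $\epsilon>0$, $n\times n$ matrices can be multiplied by algebraic (bilinear) algorithms of rank $O(n^{\tau+\epsilon})$. For a simple graph $G=(V,E)$, let $D(G)$ be the set of vertices that are missed by at least one maximum matching of $G$, let $K(G)$ be the set of vertices in $V\setminus D(G)$ that are adjacent to a vertex of $D(G)$, and let $C(G)=V\setminus(D(G)\cup K(G))$; the triple $(D(G),K(G),C(G))$ is the Gallai–Edmonds decomposition of $G$. In the congested clique model, $n$ nodes communicate in synchronous rounds; in each round each node can send to every other node a (possibly different) message of $O(\log n)$ bits; local computation is unrestricted, and each node has its own private randomness. The input is a simple graph $G$ on $n$ vertices, where initially node $\ell$ knows only the set of vertices adjacent to the $\ell$-th vertex. Theorem. The randomized round complexity of computing the Gallai–Edmonds decomposition of a simple graph with $n$ vertices in the congested clique model is $O(n^{1-1/\omega})$, where, as usual, an $o(1)$ term in the exponent is ignored. Precisely: for every $\epsilon>0$, every message-size constant $c\ge 1$ and every $k\ge 0$ there is a constant $C$ such that for every $n\ge 1$ there is a randomized protocol for $n$ nodes,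 with messages of $c\lceil\log_2 n\rceil$ bits and with at most $C\,n^{1-1/\omega+\epsilon}$ rounds, such that for every simple graph $G$ on $n$ vertices, with probability at least $1-n^{-k}$, all nodes output $(D(G),K(G),C(G))$. -/

import Mathlib

/-! ### The exponent of matrix multiplication -/

/-- There is an algebraic (bilinear) algorithm of rank `t` over the field `K` for the product of two
`n × n` matrices: coefficients `a`, `b`, `l` in `K` such that every entry of `A * B` is
`∑ μ, l i j μ * S μ * T μ`, where `S μ` and `T μ` are the linear forms in the entries of `A` and of
`B` with coefficients `a` and `b`. -/
def HasBilinearAlgorithm (K : Type) [Field K] (n t : ℕ) : Prop :=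
  ∃ a b l : Fin n → Fin n → Fin t → K, ∀ (A B : Matrix (Fin n) (Fin n) K) (i j : Fin n),
    (A * B) i j = ∑ μ : Fin t,
      l i j μ * (∑ i' : Fin n, ∑ j' : Fin n, a i' j' μ * A i' j') *
        (∑ i' : Fin n, ∑ j' : Fin n, b i' j' μ * B j' i')

/-- The exponent of square matrix multiplication over `K`: the infimum of the `τ` such that
`n × n` matrices can be multiplied by bilinear algorithms of rank `O(n ^ (τ + ε))`
for every `ε > 0`. -/
noncomputable def matMulExponent (K : Type) [Field K] : ℝ :=
  sInf {τ : ℝ | ∀ ε : ℝ, 0 < ε → ∃ C : ℝ, ∀ n : ℕ, 1 ≤ n →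
    ∃ t : ℕ, (t : ℝ) ≤ C * (n : ℝ) ^ (τ + ε) ∧ HasBilinearAlgorithm K n t}

/-! ### The congested clique model -/

/-- A randomized protocol for `n` fully connected nodes working in synchronous rounds, in which
every node sends in every round one message of `B` bits to each node (the messages to different
nodes may differ). Every node starts with its own input in `In` and its own private random seed, and
ends with an output in `Out`. Local computation is not restricted. -/
structure CliqueProtocol (n B : ℕ) (In Out : Type) where
  /-- the finite set from which each node draws its private random seed -/
  Seed : Type
  seedFinite : Finite Seed
  seedNonempty : Nonempty Seed
  /-- the possible local states of a node -/
  State : Type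
  /-- the number of rounds -/
  rounds : ℕ
  /-- the initial state of a node, from its input and its seed -/
  init : Fin n → In → Seed → State
  /-- `send t v s w` is the message that node `v`, in state `s`, sends to node `w` in round `t` -/
  send : ℕ → Fin n → State → Fin n → (Fin B → Bool)
  /-- `step t v s m` is the next state of node `v`, in state `s`, when in round `t` it receives the
  message `m w` from each node `w` -/
  step : ℕ → Fin n → State → (Fin n → (Fin B → Bool)) → State
  /-- the output of a node, from its final state -/
  output : Fin n → State → Out

namespace CliqueProtocol

variable {n B : ℕ} {In Out : Type}

/-- The states of all nodes after `t` rounds, on inputs `x` and seeds `r`. -/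
def stateAfter (P : CliqueProtocol n B In Out) (x : Fin n → In) (r : Fin n → P.Seed) :
    ℕ → Fin n → P.State
  | 0 => fun v => P.init v (x v) (r v)
  | t + 1 => fun v =>
      P.step t v (P.stateAfter x r t v) (fun w => P.send t w (P.stateAfter x r t w) v)

/-- The outputs of all nodes after the last round, on inputs `x` and seeds `r`. -/
def run (P : CliqueProtocol n B In Out) (x : Fin n → In) (r : Fin n → P.Seed) : Fin n → Out :=
  fun v => P.output v (P.stateAfter x r P.rounds v)

/-- The probability, over independent uniformly random seeds of the nodes, that the outputs of the
nodes on inputs `x` satisfy `good`. -/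
noncomputable def successProb (P : CliqueProtocol n B In Out) (x : Fin n → In)
    (good : (Fin n → Out) → Prop) : ℝ :=
  (Nat.card {r : Fin n → P.Seed // good (P.run x r)} : ℝ) / (Nat.card (Fin n → P.Seed) : ℝ)

end CliqueProtocol

/-! ### The Gallai–Edmonds decomposition -/

namespace SimpleGraph

variable {V : Type}

/-- A matching with the largest number of edges. -/
def IsMaximumMatching (G : SimpleGraph V) (M : G.Subgraph) : Prop :=
  M.IsMatching ∧ ∀ M' : G.Subgraph, M'.IsMatching → M'.edgeSet.ncard ≤ M.edgeSet.ncard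

/-- `D(G)`: the non-critical vertices, i.e. those missed by some maximum matching. -/
def gallaiEdmondsD (G : SimpleGraph V) : Set V :=
  {v | ∃ M : G.Subgraph, G.IsMaximumMatching M ∧ v ∉ M.verts}

/-- `K(G)`: the vertices outside `D(G)` with a neighbour in `D(G)`. -/
def gallaiEdmondsK (G : SimpleGraph V) : Set V :=
  {v | v ∉ G.gallaiEdmondsD ∧ ∃ w ∈ G.gallaiEdmondsD, G.Adj v w}

/-- `C(G)`: the remaining vertices. -/
def gallaiEdmondsC (G : SimpleGraph V) : Set V :=
  (G.gallaiEdmondsD ∪ G.gallaiEdmondsK)ᶜ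

/-- The Gallai–Edmonds decomposition `(D(G), K(G), C(G))`. -/
def gallaiEdmonds (G : SimpleGraph V) : Set V × Set V × Set V :=
  (G.gallaiEdmondsD, G.gallaiEdmondsK, G.gallaiEdmondsC)

end SimpleGraph

/-! ### Knowledge of the nodes -/

/-! Let `A` be the Tutte matrix of `G` with random entries in a field of characteristic other than
2. The coefficient of `X ^ d` in `det (1 - X A)` is, up to sign, the sum of the principal minors of
size `d` (`Matrix.charpolyRev_eq_sum_principal`). A nonvanishing principal minor of a skew-symmetric
matrix carries a perfect matching of its index set
(`Matrix.exists_isMatching_of_principal_det_ne_zero`), so the degree of `det (1 - X A)` is at most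
the number of vertices covered by a maximum matching, with equality for generic entries. Zeroing row
`v` leaves only the minors that avoid `v`; the degree can then stay the same only if some maximum
matching misses `v`, that is, if `v ∈ D(G)`, and for generic entries it does so for each such `v`.
By Cramer's rule the quotient of the two polynomials is the generating function of `(A ^ m) v v`
(`Matrix.charpolyRev_mul_mk_pow_apply`). Hence, generically, `v ∈ D(G)` iff this rational function
is not strictly proper, which its coefficients up to `2 n` decide (`isStrictlyProper_iff`).
Genericity is the nonvanishing of `n + 1` polynomials of degree at most `n`, so Schwartz–Zippel
bounds the failure probability by `(n + 1) n / p` over `ZMod p`.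

The required diagonal entries come from baby steps and giant steps: with `q` about `2 √n`, the
powers `A ^ i` and `(A ^ q) ^ i` for `i ≤ q` suffice, because skew symmetry lets node `v` read
column `v` from its own row. Repeated doubling produces them by logarithmically many batches of
about `2 √n` products.

A batch is multiplied blockwise with a tensor of format `m` and rank `t` about `√n`
(`Evolves.mul_batch`). There are then `O(n)` block products, a bounded number per node. Each
involves blocks of side about `n / m` with `m` about `n ^ (1 / (2 ω))`, hence `n ^ (2 - 1/ω)` words
per node, or `n ^ (1 - 1/ω)` rounds up to logarithms. Tensors of all needed sizes are tensor powers
of one tensor over `ℚ`, reduced modulo `p`.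

Protocols are handled through indistinguishability relations on pairs of a graph and a choice of
seeds: communication refines the relations, and a node can compute whatever is constant on its
classes. -/

/-- Whoever can distinguish scenarios only up to `S` can compute `f`. -/
def Knows {Ω α : Type*} (S : Setoid Ω) (f : Ω → α) : Prop :=
  ∀ ω ω', S ω ω' → f ω = f ω'

theorem Knows.mono {Ω α : Type*} {S T : Setoid Ω} {f : Ω → α} (h : Knows S f) (hTS : T ≤ S) :
    Knows T f := fun ω ω' hT => h ω ω' (hTS hT)

theorem Knows.comp {Ω α β : Type*} {S : Setoid Ω} {f : Ω → α} (h : Knows S f) (φ : α → β) :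
    Knows S (fun ω => φ (f ω)) := fun ω ω' hS => congrArg φ (h ω ω' hS)

theorem Knows.const {Ω α : Type*} {S : Setoid Ω} (a : α) : Knows S (fun _ : Ω => a) :=
  fun _ _ _ => rfl

/-- `Evolves B R K K'`: in `R` rounds with messages of `B` bits, the knowledge of the nodes can grow
from `K` to `K'`, where `K v` is the relation of being indistinguishable to node `v`. -/
inductive Evolves {n : ℕ} {Ω : Type} (B : ℕ) :
    ℕ → (Fin n → Setoid Ω) → (Fin n → Setoid Ω) → Prop
  | refl (K : Fin n → Setoid Ω) : Evolves B 0 K K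
  | round {R : ℕ} {K K' : Fin n → Setoid Ω} (h : Evolves B R K K')
      (M : Fin n → Fin n → Ω → (Fin B → Bool)) (hM : ∀ v w, Knows (K' v) (M v w)) :
      Evolves B (R + 1) K (fun v => K' v ⊓ Setoid.ker (fun ω w => M w v ω))

namespace Evolves

variable {n B : ℕ} {Ω : Type} {K K₁ K₂ : Fin n → Setoid Ω}

theorem le {R : ℕ} (h : Evolves B R K K₁) (v : Fin n) : K₁ v ≤ K v := by
  induction h with
  | refl => exact le_rfl
  | round _ _ _ ih => exact inf_le_left.trans ih

theorem trans {R R' : ℕ} (h : Evolves B R K K₁) (h' : Evolves B R' K₁ K₂) :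
    Evolves B (R + R') K K₂ := by
  induction h' with
  | refl => exact h
  | round _ M hM ih => exact (ih h).round M hM

/-- The knowledge of the nodes after some rounds, if `M t v w` is the message that `v` sends to `w`
in round `t`. -/
def knowledge (K : Fin n → Setoid Ω) (M : ℕ → Fin n → Fin n → Ω → (Fin B → Bool)) :
    ℕ → Fin n → Setoid Ω
  | 0 => K
  | t + 1 => fun v => knowledge K M t v ⊓ Setoid.ker (fun ω w => M t w v ω)

theorem knowledge_congr {M M' : ℕ → Fin n → Fin n → Ω → (Fin B → Bool)} {t : ℕ}
    (h : ∀ s < t, M s = M' s) : knowledge K M t = knowledge K M' t := by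
  induction t with
  | zero => rfl
  | succ t ih =>
    simp only [knowledge, ih fun s hs => h s (by omega), h t (by omega)]

theorem exists_schedule {R : ℕ} (h : Evolves B R K K₁) :
    ∃ M : ℕ → Fin n → Fin n → Ω → (Fin B → Bool),
      (∀ t < R, ∀ v w, Knows (knowledge K M t v) (M t v w)) ∧ knowledge K M R = K₁ := by
  induction h with
  | refl => exact ⟨fun _ _ _ _ _ => false, by simp, rfl⟩
  | @round R K K' _ M hM ih =>
    obtain ⟨M₀, h₀, hK⟩ := ih
    have hc : ∀ t ≤ R, knowledge K (Function.update M₀ R M) t = knowledge K M₀ t := fun t ht =>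
      knowledge_congr fun s hs => Function.update_of_ne (by omega) _ _
    refine ⟨Function.update M₀ R M, fun t ht v w => ?_, ?_⟩
    · rw [hc t (by omega)]
      rcases Nat.lt_succ_iff_lt_or_eq.mp ht with h | rfl
      · rw [Function.update_of_ne (by omega)]
        exact h₀ t h v w
      · rw [Function.update_self, hK]
        exact hM v w
    · simp only [knowledge, hc R le_rfl, hK, Function.update_self]

/-- Nodes that reach the knowledge of `out` can be implemented by a protocol: the state of a node
is the set of the scenarios that are consistent with all that it has seen. -/
theorem exists_protocol {In Out Seed Γ : Type} [Finite Seed] [Nonempty Seed] [Nonempty Out] {R : ℕ}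
    (input : Γ → Fin n → In) {K' : Fin n → Setoid (Γ × (Fin n → Seed))}
    (h : Evolves B R (fun v => Setoid.ker fun ω => (input ω.1 v, ω.2 v)) K')
    (out : Fin n → Γ × (Fin n → Seed) → Out) (hout : ∀ v, Knows (K' v) (out v)) :
    ∃ P : CliqueProtocol n B In Out, P.rounds = R ∧
      ∀ (g : Γ) (good : (Fin n → Out) → Prop), P.successProb (input g) good =
        (Nat.card {r : Fin n → Seed // good fun v => out v (g, r)} : ℝ) /
          (Nat.card (Fin n → Seed) : ℝ) := by
  classical
  obtain ⟨M, hM, rfl⟩ := h.exists_schedule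
  set K := fun v => Setoid.ker fun ω : Γ × (Fin n → Seed) => (input ω.1 v, ω.2 v) with hKdef
  let P : CliqueProtocol n B In Out :=
    { Seed := Seed
      seedFinite := inferInstance
      seedNonempty := inferInstance
      State := Set (Γ × (Fin n → Seed))
      rounds := R
      init := fun v x r => {ω | input ω.1 v = x ∧ ω.2 v = r}
      -- Any consistent scenario serves as representative, since the message is constant on the
      -- class. The default is never reached in a run: the true scenario always stays consistent.
      send := fun t v s w => if hs : s.Nonempty then M t v w hs.some else fun _ => false
      step := fun t v s m => {ω | ω ∈ s ∧ ∀ w, M t w v ω = m w}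
      output := fun v s => if hs : s.Nonempty then out v hs.some else Classical.arbitrary Out }
  have key : ∀ (g : Γ) (r : Fin n → Seed), ∀ t ≤ R, ∀ v,
      P.stateAfter (input g) r t v = {ω | knowledge K M t v (g, r) ω} := by
    intro g r t
    induction t with
    | zero =>
      intro _ v
      ext ω
      change input ω.1 v = input g v ∧ ω.2 v = r v ↔ (input g v, r v) = (input ω.1 v, ω.2 v)
      rw [Prod.mk.injEq, eq_comm, @eq_comm _ (ω.2 v)]
    | succ t ih =>
      intro ht v
      have ih' := ih (by omega)
      have hsend : ∀ w, P.send t w (P.stateAfter (input g) r t w) v = M t w v (g, r) := by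
        intro w
        rw [ih' w]
        have hne : {ω | knowledge K M t w (g, r) ω}.Nonempty :=
          ⟨(g, r), (knowledge K M t w).refl _⟩
        simp only [P, dif_pos hne]
        exact (hM t (by omega) w v _ _ hne.some_mem).symm
      ext ω
      simp only [CliqueProtocol.stateAfter, hsend]
      rw [ih' v]
      change (knowledge K M t v (g, r) ω ∧ ∀ w, M t w v ω = M t w v (g, r)) ↔
        (knowledge K M t v (g, r) ω ∧ (fun w => M t w v (g, r)) = fun w => M t w v ω)
      rw [funext_iff]
      exact and_congr_right fun _ => forall_congr' fun w => eq_comm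
  have hrun : ∀ (g : Γ) (r : Fin n → Seed), P.run (input g) r = fun v => out v (g, r) := by
    intro g r
    funext v
    have hne : {ω | knowledge K M R v (g, r) ω}.Nonempty :=
      ⟨(g, r), (knowledge K M R v).refl _⟩
    change P.output v (P.stateAfter (input g) r R v) = _
    rw [key g r R le_rfl v]
    simp only [P, dif_pos hne]
    exact (hout v _ _ hne.some_mem).symm
  refine ⟨P, rfl, fun g good => ?_⟩
  change (Nat.card {r : Fin n → Seed // good (P.run (input g) r)} : ℝ) /
    (Nat.card (Fin n → Seed) : ℝ) = _
  simp only [hrun]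

/-! ### Oblivious routing -/

/-- Messages are delivered over relays in two rounds, if no two messages with the same sender and no
two messages with the same receiver have the same relay. -/
theorem relay {J : Type*} (hB : 1 ≤ B) (K : Fin n → Setoid Ω) (src dst via : J → Fin n)
    (hsrc : ∀ j j', src j = src j' → via j = via j' → j = j')
    (hdst : ∀ j j', dst j = dst j' → via j = via j' → j = j')
    (bit : J → Ω → Bool) (hbit : ∀ j, Knows (K (src j)) (bit j)) :
    ∃ K', Evolves B 2 K K' ∧ ∀ j, Knows (K' (dst j)) (bit j) := by
  classical
  let M₁ : Fin n → Fin n → Ω → (Fin B → Bool) := fun u z ω _ =>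
    if h : ∃ j, src j = u ∧ via j = z then bit h.choose ω else false
  let M₂ : Fin n → Fin n → Ω → (Fin B → Bool) := fun z v ω _ =>
    if h : ∃ j, dst j = v ∧ via j = z then bit h.choose ω else false
  have h₁ : ∀ u z, Knows (K u) (M₁ u z) := by
    intro u z ω ω' hω
    funext i
    by_cases h : ∃ j, src j = u ∧ via j = z
    · simp only [M₁, dif_pos h]
      have hs := h.choose_spec
      exact hbit h.choose ω ω' (by rw [hs.1]; exact hω)
    · simp only [M₁, dif_neg h]
  have e₁ := (Evolves.refl (B := B) K).round M₁ h₁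
  have k₁ : ∀ j, Knows (K (via j) ⊓ Setoid.ker fun ω w => M₁ w (via j) ω) (bit j) := by
    intro j ω ω' hω
    have h := congrFun (congrFun (show (fun w => M₁ w (via j) ω) = fun w => M₁ w (via j) ω' from
      hω.2) (src j)) ⟨0, hB⟩
    have hex : ∃ j', src j' = src j ∧ via j' = via j := ⟨j, rfl, rfl⟩
    simp only [M₁, dif_pos hex] at h
    rwa [hsrc _ _ hex.choose_spec.1 hex.choose_spec.2] at h
  have h₂ : ∀ z v, Knows (K z ⊓ Setoid.ker fun ω w => M₁ w z ω) (M₂ z v) := by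
    intro z v ω ω' hω
    funext i
    by_cases h : ∃ j, dst j = v ∧ via j = z
    · simp only [M₂, dif_pos h]
      have hs := h.choose_spec
      exact k₁ h.choose ω ω' (by rw [hs.2]; exact hω)
    · simp only [M₂, dif_neg h]
  refine ⟨_, e₁.round M₂ h₂, fun j ω ω' hω => ?_⟩
  have h := congrFun (congrFun (show (fun w => M₂ w (dst j) ω) = fun w => M₂ w (dst j) ω' from
    hω.2) (via j)) ⟨0, hB⟩
  have hex : ∃ j', dst j' = dst j ∧ via j' = via j := ⟨j, rfl, rfl⟩
  simp only [M₂, dif_pos hex] at h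
  rwa [hdst _ _ hex.choose_spec.1 hex.choose_spec.2] at h

theorem relay_batches {J : Type*} (hB : 1 ≤ B) (src dst via : J → Fin n) (batch : J → ℕ)
    (hsrc : ∀ j j', src j = src j' → via j = via j' → batch j = batch j' → j = j')
    (hdst : ∀ j j', dst j = dst j' → via j = via j' → batch j = batch j' → j = j')
    (K : Fin n → Setoid Ω)
    (bit : J → Ω → Bool) (hbit : ∀ j, Knows (K (src j)) (bit j)) (T : ℕ) :
    ∃ K', Evolves B (2 * T) K K' ∧ ∀ j, batch j < T → Knows (K' (dst j)) (bit j) := by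
  induction T with
  | zero => exact ⟨K, .refl K, by simp⟩
  | succ T ih =>
    obtain ⟨K₁, e₁, k₁⟩ := ih
    obtain ⟨K₂, e₂, k₂⟩ := relay (J := {j // batch j = T}) hB K₁ (fun j => src j) (fun j => dst j)
      (fun j => via j)
      (fun j j' h h' => Subtype.ext (hsrc _ _ h h' (j.2.trans j'.2.symm)))
      (fun j j' h h' => Subtype.ext (hdst _ _ h h' (j.2.trans j'.2.symm)))
      (fun j => bit j) (fun j => (hbit j).mono (e₁.le _))
    refine ⟨K₂, e₁.trans e₂, fun j hj => ?_⟩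
    rcases Nat.lt_succ_iff_lt_or_eq.mp hj with h | h
    · exact (k₁ j h).mono (e₂.le _)
    · exact k₂ ⟨j, h⟩

end Evolves

/-! ### Scheduling by greedy colouring. -/

theorem exists_greedy_coloring {J : Type*} [Fintype J] (r : J → J → Prop) [DecidableRel r]
    (hr : ∀ i j, r i j → r j i) (N : ℕ) (hN : ∀ j, (Finset.univ.filter (r j)).card < N) :
    ∃ color : J → Fin N, ∀ i j, r i j → i ≠ j → color i ≠ color j := by
  classical
  suffices H : ∀ s : Finset J, ∃ color : J → Fin N, ∀ i ∈ s, ∀ j ∈ s, r i j → i ≠ j →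
      color i ≠ color j by
    obtain ⟨c, hc⟩ := H Finset.univ
    exact ⟨c, fun i j => hc i (Finset.mem_univ _) j (Finset.mem_univ _)⟩
  intro s
  induction s using Finset.induction_on with
  | empty =>
    by_cases h : Nonempty J
    · exact ⟨fun _ => ⟨0, (Nat.zero_le _).trans_lt (hN h.some)⟩, by simp⟩
    · exact ⟨fun j => (h ⟨j⟩).elim, by simp⟩
  | insert a s ha ih =>
    obtain ⟨c, hc⟩ := ih
    obtain ⟨x, hx⟩ : ∃ x, x ∉ (Finset.univ.filter (r a)).image c := by
      by_contra! hcon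
      have h := Finset.card_le_card (fun x _ => hcon x : Finset.univ ⊆ _)
      rw [Finset.card_univ, Fintype.card_fin] at h
      exact absurd (h.trans Finset.card_image_le) (not_le.mpr (hN a))
    have hx' : ∀ j, r a j → c j ≠ x := fun j hj he =>
      hx (Finset.mem_image.mpr ⟨j, by simpa using hj, he⟩)
    refine ⟨Function.update c a x, fun i hi j hj hij hne => ?_⟩
    by_cases hia : i = a
    · subst hia
      rw [Function.update_self, Function.update_of_ne hne.symm]
      exact (hx' j hij).symm
    · by_cases hja : j = a
      · subst hja
        rw [Function.update_self, Function.update_of_ne hia]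
        exact hx' i (hr _ _ hij)
      · rw [Function.update_of_ne hia, Function.update_of_ne hja]
        exact hc i (Finset.mem_of_mem_insert_of_ne hi hia) j
          (Finset.mem_of_mem_insert_of_ne hj hja) hij hne

namespace Evolves

variable {n B : ℕ} {Ω : Type}

/-- Two messages conflict if they share a sender or a receiver. Each message conflicts with fewer
than `2 L n` messages, itself included, so `2 L n` colours suffice; they are spread over `n` relays
and `2 L` batches of two rounds. -/
theorem route_bits {J : Type*} [Fintype J] (hB : 1 ≤ B) (hn : 0 < n) (K : Fin n → Setoid Ω)
    (src dst : J → Fin n) (L : ℕ)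
    (hsrc : ∀ u, (Finset.univ.filter fun j => src j = u).card ≤ L * n)
    (hdst : ∀ u, (Finset.univ.filter fun j => dst j = u).card ≤ L * n)
    (bit : J → Ω → Bool) (hbit : ∀ j, Knows (K (src j)) (bit j)) :
    ∃ K', Evolves B (4 * L) K K' ∧ ∀ j, Knows (K' (dst j)) (bit j) := by
  classical
  obtain ⟨color, hcolor⟩ := exists_greedy_coloring (J := J)
    (fun i j => (src i = src j ∨ dst i = dst j)) (fun i j h => h.imp Eq.symm Eq.symm)
    (2 * L * n) (by
      intro j
      have h₁ : (Finset.univ.filter fun i => (src j = src i ∨ dst j = dst i)) =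
          (Finset.univ.filter fun i => src i = src j) ∪
          (Finset.univ.filter fun i => dst i = dst j) := by
        ext i
        simp [eq_comm]
      have h₂ := Finset.card_union_add_card_inter (Finset.univ.filter fun i => src i = src j)
        (Finset.univ.filter fun i => dst i = dst j)
      -- The message `j` is counted in both fibres; this makes the bound on the union strict, as the
      -- greedy colouring needs.
      have h₃ : 0 < ((Finset.univ.filter fun i => src i = src j) ∩
          (Finset.univ.filter fun i => dst i = dst j)).card :=
        Finset.card_pos.mpr ⟨j, by simp⟩
      rw [h₁]
      have := hsrc (src j)
      have := hdst (dst j)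
      have : 2 * L * n = L * n + L * n := by ring
      omega)
  have hinj : ∀ i j : J, (color i).val % n = (color j).val % n →
      (color i).val / n = (color j).val / n → color i = color j := fun i j h h' => by
    apply Fin.ext
    rw [← Nat.div_add_mod (color i).val n, ← Nat.div_add_mod (color j).val n, h, h']
  -- The colour modulo `n` is the relay and the colour divided by `n` is the batch.
  obtain ⟨K', e, k⟩ := relay_batches hB src dst (fun j => ⟨(color j).val % n, Nat.mod_lt _ hn⟩)
    (fun j => (color j).val / n)
    (fun i j h h' h'' => by
      by_contra hne
      exact hcolor i j (Or.inl h) hne (hinj i j (by simpa using h') h''))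
    (fun i j h h' h'' => by
      by_contra hne
      exact hcolor i j (Or.inr h) hne (hinj i j (by simpa using h') h''))
    K bit hbit (2 * L)
  refine ⟨K', by convert e using 1; ring, fun j => k j ?_⟩
  exact Nat.div_lt_of_lt_mul (lt_of_lt_of_eq (color j).2 (mul_comm _ _))

/-- Oblivious routing of words from an alphabet with at most `2 ^ b` letters. -/
theorem route {J : Type*} [Fintype J] {α : Type*} [Fintype α] (hB : 1 ≤ B) (hn : 0 < n) {b : ℕ}
    (hα : Fintype.card α ≤ 2 ^ b) (K : Fin n → Setoid Ω) (src dst : J → Fin n) (L : ℕ)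
    (hsrc : ∀ u, (Finset.univ.filter fun j => src j = u).card ≤ L * n)
    (hdst : ∀ u, (Finset.univ.filter fun j => dst j = u).card ≤ L * n)
    (word : J → Ω → α) (hword : ∀ j, Knows (K (src j)) (word j)) :
    ∃ K', Evolves B (4 * (L * b)) K K' ∧ ∀ j, Knows (K' (dst j)) (word j) := by
  classical
  obtain ⟨enc⟩ : Nonempty (α ↪ (Fin b → Bool)) :=
    Function.Embedding.nonempty_of_card_le (by simpa using hα)
  have hcard : ∀ (f : J → Fin n), (∀ u, (Finset.univ.filter fun j => f j = u).card ≤ L * n) →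
      ∀ u, (Finset.univ.filter fun j : J × Fin b => f j.1 = u).card ≤ L * b * n := by
    intro f hf u
    have : (Finset.univ.filter fun j : J × Fin b => f j.1 = u) =
        (Finset.univ.filter fun j => f j = u) ×ˢ (Finset.univ : Finset (Fin b)) := by
      ext ⟨j, i⟩
      simp
    rw [this, Finset.card_product, Finset.card_univ, Fintype.card_fin]
    calc _ ≤ L * n * b := Nat.mul_le_mul_right _ (hf u)
      _ = _ := by ring
  obtain ⟨K', e, k⟩ := route_bits (J := J × Fin b) hB hn K (fun j => src j.1) (fun j => dst j.1)
    (L * b) (hcard src hsrc) (hcard dst hdst) (fun j ω => enc (word j.1 ω) j.2)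
    (fun j => (hword j.1).comp fun a => enc a j.2)
  exact ⟨K', e, fun j ω ω' hω => enc.injective (funext fun i => k (j, i) ω ω' hω)⟩

end Evolves

/-! ### Matrix multiplication tensors -/

/-- The coefficients `a`, `b`, `l` form a decomposition, with summands indexed by `τ`, of the
matrix multiplication tensor. -/
def IsMatMulTensor {F ι τ : Type*} [CommSemiring F] [DecidableEq ι] [Fintype τ]
    (a b l : ι → ι → τ → F) : Prop :=
  ∀ i j i' k k' j', ∑ μ, l i j μ * a i' k μ * b k' j' μ =
    if i = i' ∧ k = k' ∧ j = j' then 1 else 0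

/-- The rank of the tensor of the multiplication of `m × m` matrices over `F` is at most `t`. -/
def HasMatMulTensor (F : Type*) [CommSemiring F] (m t : ℕ) : Prop :=
  ∃ a b l : Fin m → Fin m → Fin t → F, IsMatMulTensor a b l

theorem HasBilinearAlgorithm.hasMatMulTensor {K : Type} [Field K] {m t : ℕ}
    (h : HasBilinearAlgorithm K m t) : HasMatMulTensor K m t := by
  obtain ⟨a, b, l, h⟩ := h
  refine ⟨a, fun k j => b j k, l, fun i j i' k k' j' => ?_⟩
  have h₁ := h (Matrix.single i' k 1) (Matrix.single k' j' 1) i j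
  simp only [Matrix.single_apply, mul_ite, mul_one, mul_zero, ite_and, Finset.sum_ite_eq,
    Finset.sum_ite_irrel, Finset.sum_const_zero, Finset.mem_univ, if_true] at h₁
  rw [← h₁]
  by_cases hk : k = k'
  · subst hk
    simp [Matrix.single_apply, ite_and, eq_comm]
  · simp [hk]

namespace IsMatMulTensor

variable {F ι ι' τ τ' : Type*} [DecidableEq ι] [DecidableEq ι'] [Fintype τ] [Fintype τ']

/-- Multiplication of block matrices, with blocks indexed by `κ`. -/
theorem mul_apply [CommSemiring F] [Fintype ι] {κ : Type*} [Fintype κ] {a b l : ι → ι → τ → F}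
    (h : IsMatMulTensor a b l) (X Y : Matrix (ι × κ) (ι × κ) F) (i j : ι) (x z : κ) :
    (X * Y) (i, x) (j, z) = ∑ μ, l i j μ * ∑ y,
      (∑ q : ι × ι, a q.1 q.2 μ * X (q.1, x) (q.2, y)) *
      (∑ q : ι × ι, b q.1 q.2 μ * Y (q.1, y) (q.2, z)) := by
  -- For fixed `x`, `y`, `z` this is the bilinear algorithm applied to the two matrices formed by
  -- the entries at positions `(x, y)` and `(y, z)` of all blocks.
  have hterm : ∀ y, ∑ μ, l i j μ * ((∑ q : ι × ι, a q.1 q.2 μ * X (q.1, x) (q.2, y)) *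
      (∑ q : ι × ι, b q.1 q.2 μ * Y (q.1, y) (q.2, z))) =
      ∑ k, X (i, x) (k, y) * Y (k, y) (j, z) := by
    intro y
    calc _ = ∑ μ, ∑ q : ι × ι, ∑ q' : ι × ι, (l i j μ * a q.1 q.2 μ * b q'.1 q'.2 μ) *
          (X (q.1, x) (q.2, y) * Y (q'.1, y) (q'.2, z)) := by
          refine Finset.sum_congr rfl fun μ _ => ?_
          rw [Finset.sum_mul_sum, Finset.mul_sum]
          refine Finset.sum_congr rfl fun q _ => ?_
          rw [Finset.mul_sum]
          refine Finset.sum_congr rfl fun q' _ => ?_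
          ring
      _ = ∑ q : ι × ι, ∑ q' : ι × ι, (if i = q.1 ∧ q.2 = q'.1 ∧ j = q'.2 then 1 else 0) *
          (X (q.1, x) (q.2, y) * Y (q'.1, y) (q'.2, z)) := by
          rw [Finset.sum_comm]
          refine Finset.sum_congr rfl fun q _ => ?_
          rw [Finset.sum_comm]
          refine Finset.sum_congr rfl fun q' _ => ?_
          rw [← Finset.sum_mul, h]
      _ = _ := by
          simp only [ite_mul, one_mul, zero_mul, Fintype.sum_prod_type, ite_and, Finset.sum_ite_eq,
            Finset.sum_ite_irrel, Finset.sum_const_zero, Finset.mem_univ, if_true]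
  calc (X * Y) (i, x) (j, z) = ∑ y, ∑ k, X (i, x) (k, y) * Y (k, y) (j, z) := by
        rw [Matrix.mul_apply, Fintype.sum_prod_type, Finset.sum_comm]
    _ = _ := by
        simp only [Finset.mul_sum (s := (Finset.univ : Finset κ)), ← hterm]
        rw [Finset.sum_comm]

/-- The Kronecker product of two decompositions; the sum over pairs of summands factors. -/
theorem prod [CommSemiring F] {a b l : ι → ι → τ → F} {a' b' l' : ι' → ι' → τ' → F}
    (h : IsMatMulTensor a b l) (h' : IsMatMulTensor a' b' l') :
    IsMatMulTensor (fun (i j : ι × ι') (μ : τ × τ') => a i.1 j.1 μ.1 * a' i.2 j.2 μ.2)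
      (fun i j μ => b i.1 j.1 μ.1 * b' i.2 j.2 μ.2)
      (fun i j μ => l i.1 j.1 μ.1 * l' i.2 j.2 μ.2) := by
  intro i j i' k k' j'
  have : ∀ μ : τ × τ', l i.1 j.1 μ.1 * l' i.2 j.2 μ.2 * (a i'.1 k.1 μ.1 * a' i'.2 k.2 μ.2) *
      (b k'.1 j'.1 μ.1 * b' k'.2 j'.2 μ.2) =
      (l i.1 j.1 μ.1 * a i'.1 k.1 μ.1 * b k'.1 j'.1 μ.1) *
      (l' i.2 j.2 μ.2 * a' i'.2 k.2 μ.2 * b' k'.2 j'.2 μ.2) := fun μ => by ring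
  simp only [this, Fintype.sum_prod_type]
  rw [← Finset.sum_mul_sum, h, h', ite_zero_mul_ite_zero, mul_one]
  refine if_congr ?_ rfl rfl
  simp only [Prod.ext_iff]
  tauto

theorem reindex [CommSemiring F] {a b l : ι → ι → τ → F} (h : IsMatMulTensor a b l)
    (e : ι' ≃ ι) (f : τ' ≃ τ) :
    IsMatMulTensor (fun i j μ => a (e i) (e j) (f μ)) (fun i j μ => b (e i) (e j) (f μ))
      (fun i j μ => l (e i) (e j) (f μ)) := by
  intro i j i' k k' j'
  have := h (e i) (e j) (e i') (e k) (e k') (e j')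
  simp only [e.injective.eq_iff] at this
  rw [← this]
  exact f.sum_comp fun μ => l (e i) (e j) μ * a (e i') (e k) μ * b (e k') (e j') μ

/-- The coefficient vectors `a i k` in `τ → F` are linearly independent: contracting a relation with
`l i i` and `b k i` isolates the coefficient at `(i, k)`. This is the source of `2 ≤ ω`. -/
theorem sq_card_le [Field F] [Fintype ι] {a b l : ι → ι → τ → F} (h : IsMatMulTensor a b l) :
    Fintype.card ι ^ 2 ≤ Fintype.card τ := by
  have hli : LinearIndependent F fun q : ι × ι => a q.1 q.2 := by
    rw [Fintype.linearIndependent_iff]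
    intro g hg ⟨i, k⟩
    have h₁ : ∑ q : ι × ι, g q * ∑ μ, l i i μ * a q.1 q.2 μ * b k i μ = g (i, k) := by
      simp only [h i i _ _ k i, mul_ite, mul_one, mul_zero, and_true, ite_and,
        Fintype.sum_prod_type, Finset.sum_ite_eq, Finset.sum_ite_eq', Finset.sum_ite_irrel,
        Finset.sum_const_zero, Finset.mem_univ, if_true]
    rw [← h₁]
    calc _ = ∑ μ, l i i μ * b k i μ * (∑ q : ι × ι, g q • a q.1 q.2) μ := by
          simp only [Finset.mul_sum, Finset.sum_apply, Pi.smul_apply, smul_eq_mul]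
          rw [Finset.sum_comm]
          refine Finset.sum_congr rfl fun μ _ => Finset.sum_congr rfl fun q _ => ?_
          ring
      _ = 0 := by
          rw [hg]
          simp
  have := hli.fintype_card_le_finrank
  rwa [Fintype.card_prod, Module.finrank_fintype_fun_eq_card, ← sq] at this

end IsMatMulTensor

namespace HasMatMulTensor

theorem mul {F : Type*} [CommSemiring F] {m t m' t' : ℕ} (h : HasMatMulTensor F m t)
    (h' : HasMatMulTensor F m' t') : HasMatMulTensor F (m * m') (t * t') := by
  obtain ⟨a, b, l, h⟩ := h
  obtain ⟨a', b', l', h'⟩ := h'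
  exact ⟨_, _, _, (h.prod h').reindex finProdFinEquiv.symm finProdFinEquiv.symm⟩

theorem pow {F : Type*} [CommSemiring F] {m t : ℕ} (h : HasMatMulTensor F m t) (r : ℕ) :
    HasMatMulTensor F (m ^ r) (t ^ r) := by
  induction r with
  | zero =>
    refine ⟨fun _ _ _ => 1, fun _ _ _ => 1, fun _ _ _ => 1, fun i j i' k k' j' => ?_⟩
    rw [if_pos ⟨Subsingleton.elim (α := Fin 1) _ _, Subsingleton.elim (α := Fin 1) _ _,
      Subsingleton.elim (α := Fin 1) _ _⟩]
    exact (Fintype.sum_unique (ι := Fin 1) _).trans (by simp)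
  | succ r ih => simpa only [pow_succ] using ih.mul h

theorem sq_le {F : Type*} [Field F] {m t : ℕ} (h : HasMatMulTensor F m t) : m ^ 2 ≤ t := by
  obtain ⟨a, b, l, h⟩ := h
  simpa using h.sq_card_le

/-- The schoolbook algorithm, one product per triple of indices. It shows that the infimum defining
the exponent is over a nonempty set. -/
theorem naive (F : Type*) [CommSemiring F] (m : ℕ) : HasMatMulTensor F m (m ^ 3) := by
  have : IsMatMulTensor (F := F) (ι := Fin m) (τ := Fin m × Fin m × Fin m)
      (fun i k μ => if μ.1 = i ∧ μ.2.1 = k then 1 else 0)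
      (fun k j μ => if μ.2.1 = k ∧ μ.2.2 = j then 1 else 0)
      (fun i j μ => if μ.1 = i ∧ μ.2.2 = j then 1 else 0) := by
    intro i j i' k k' j'
    simp only [Fintype.sum_prod_type, ite_zero_mul_ite_zero, mul_one]
    rw [Finset.sum_eq_single i, Finset.sum_eq_single k, Finset.sum_eq_single j]
    · refine if_congr ?_ rfl rfl
      tauto
    · rintro x - hx
      exact if_neg fun h => hx h.1.1.2
    · simp
    · rintro x - hx
      exact Finset.sum_eq_zero fun y _ => if_neg fun h => hx h.1.2.2
    · simp
    · rintro x - hx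
      exact Finset.sum_eq_zero fun y _ => Finset.sum_eq_zero fun z _ =>
        if_neg fun h => hx h.1.1.1
    · simp
  have e : Fin (m ^ 3) ≃ Fin m × Fin m × Fin m :=
    Fintype.equivOfCardEq (by simp; ring)
  exact ⟨_, _, _, this.reindex (Equiv.refl _) e⟩

/-- A tensor decomposition over `ℚ` gives one over every field in which the denominators of the
coefficients are invertible. -/
theorem exists_denominator {m t : ℕ} (h : HasMatMulTensor ℚ m t) :
    ∃ D : ℤ, D ≠ 0 ∧ ∀ (F : Type) [Field F], (D : F) ≠ 0 → HasMatMulTensor F m t := by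
  obtain ⟨a, b, l, h⟩ := h
  have key : ∀ f : Fin m → Fin m → Fin t → ℚ, ∃ d : ℤ, d ≠ 0 ∧ ∃ g : Fin m → Fin m → Fin t → ℤ,
      ∀ i j μ, (g i j μ : ℚ) = d * f i j μ := by
    intro f
    obtain ⟨d, hd⟩ := IsLocalization.exist_integer_multiples_of_finite (nonZeroDivisors ℤ)
      (fun q : Fin m × Fin m × Fin t => f q.1 q.2.1 q.2.2)
    choose g hg using hd
    refine ⟨d, nonZeroDivisors.coe_ne_zero d, fun i j μ => g (i, j, μ), fun i j μ => ?_⟩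
    have := hg (i, j, μ)
    simpa [Submonoid.smul_def] using this
  obtain ⟨da, hda, a', ha⟩ := key a
  obtain ⟨db, hdb, b', hb⟩ := key b
  obtain ⟨dl, hdl, l', hl⟩ := key l
  -- Clearing denominators leaves an identity over `ℤ` with `dl * da * db` in place of 1; it can be
  -- mapped to `F` and divided there.
  have hint : ∀ i j i' k k' j', ∑ μ, l' i j μ * a' i' k μ * b' k' j' μ =
      if i = i' ∧ k = k' ∧ j = j' then dl * da * db else 0 := by
    intro i j i' k k' j'
    have h₁ := congrArg (fun x : ℚ => (dl * da * db : ℚ) * x) (h i j i' k k' j')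
    rw [← Int.cast_inj (α := ℚ)]
    push_cast
    simp only [ha, hb, hl]
    simp only [Finset.mul_sum, mul_ite, mul_one, mul_zero] at h₁
    rw [← h₁]
    exact Finset.sum_congr rfl fun μ _ => by ring
  refine ⟨dl * da * db, mul_ne_zero (mul_ne_zero hdl hda) hdb, fun F _ hD => ?_⟩
  refine ⟨fun i j μ => a' i j μ, fun i j μ => b' i j μ,
    fun i j μ => ((dl * da * db : ℤ) : F)⁻¹ * l' i j μ, fun i j i' k k' j' => ?_⟩
  have h₁ := congrArg (fun x : ℤ => (x : F)) (hint i j i' k k' j')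
  simp only [Int.cast_sum, Int.cast_mul, Int.cast_ite, Int.cast_zero] at h₁
  simp only [mul_assoc] at h₁ ⊢
  rw [← Finset.mul_sum, h₁]
  split_ifs
  · rw [← inv_mul_cancel₀ hD]
    push_cast
    ring
  · simp

end HasMatMulTensor

/-! ### Products of many matrices in the congested clique -/

theorem exists_balanced_map {T : Type*} [Fintype T] {n c : ℕ} (h : Fintype.card T ≤ n * c) :
    ∃ f : T → Fin n, ∀ u, (Finset.univ.filter fun x => f x = u).card ≤ c := by
  obtain ⟨e⟩ : Nonempty (T ↪ Fin n × Fin c) :=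
    Function.Embedding.nonempty_of_card_le (by simpa using h)
  refine ⟨fun x => (e x).1, fun u => ?_⟩
  conv_rhs => rw [← Fintype.card_fin c, ← Finset.card_univ]
  refine Finset.card_le_card_of_injOn (fun x => (e x).2) (fun _ _ => Finset.mem_univ _) ?_
  intro x hx y hy hxy
  simp only [Finset.coe_filter, Finset.mem_univ, true_and] at hx hy
  exact e.injective (Prod.ext (Eq.trans hx (Eq.symm hy)) hxy)

/-- Bounds the load of a node when tasks are balanced by `f` and each task `x` concerns at most `d`
messages. -/
theorem card_fiber_comp_le {J T U : Type*} [Fintype J] [Fintype T] [DecidableEq T] [DecidableEq U]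
    (g : J → T) (f : T → U) {c d : ℕ}
    (hg : ∀ x, (Finset.univ.filter fun j => g j = x).card ≤ d)
    (hf : ∀ u, (Finset.univ.filter fun x => f x = u).card ≤ c) (u : U) :
    (Finset.univ.filter fun j => f (g j) = u).card ≤ d * c := by
  refine (Finset.card_le_mul_card_image_of_maps_to (f := g)
    (t := Finset.univ.filter fun x => f x = u) (fun j hj => by simpa using hj) d
    fun x _ => ?_).trans (Nat.mul_le_mul_left _ (hf u))
  exact (Finset.card_le_card (Finset.filter_subset_filter _ (Finset.filter_subset _ _))).trans
    (hg x)

/-- The matrix `X`, extended by zero along the embedding `e` of its index type. -/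
noncomputable def Matrix.extendZero {ι κ F : Type*} [Zero F] (e : ι ↪ κ) (X : Matrix ι ι F) :
    Matrix κ κ F :=
  open Classical in fun i j =>
    if h : ∃ q : ι × ι, e q.1 = i ∧ e q.2 = j then X h.choose.1 h.choose.2 else 0

namespace Matrix

variable {ι κ F : Type*} (e : ι ↪ κ)

theorem extendZero_apply [Zero F] (X : Matrix ι ι F) (u w : ι) :
    X.extendZero e (e u) (e w) = X u w := by
  have h : ∃ q : ι × ι, e q.1 = e u ∧ e q.2 = e w := ⟨(u, w), rfl, rfl⟩
  rw [extendZero, dif_pos h, e.injective h.choose_spec.1, e.injective h.choose_spec.2]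

theorem extendZero_mul_extendZero_apply [Fintype ι] [Fintype κ] [NonUnitalNonAssocSemiring F]
    (X Y : Matrix ι ι F) (u w : ι) :
    (X.extendZero e * Y.extendZero e) (e u) (e w) = (X * Y) u w := by
  rw [mul_apply, mul_apply]
  symm
  refine Fintype.sum_of_injective e e.injective _ _ (fun y hy => ?_) fun i => ?_
  · rw [extendZero, dif_neg, zero_mul]
    rintro ⟨q, -, hq⟩
    exact hy ⟨_, hq⟩
  · rw [extendZero_apply, extendZero_apply]

end Matrix

namespace Evolves

variable {n B : ℕ} {Ω : Type}

/-- Fast multiplication of `q` pairs of matrices whose rows are distributed over the nodes. -/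
theorem mul_batch {F : Type} [Field F] [Fintype F] (hB : 1 ≤ B) (hn : 0 < n) {b : ℕ}
    (hF : Fintype.card F ≤ 2 ^ b) {m t h q c₁ c₂ L : ℕ} (hT : HasMatMulTensor F m t)
    (hmh : n ≤ m * h) (hc₁ : q * h ^ 2 ≤ n * c₁) (hc₂ : q * t ≤ n * c₂) (hqL : q ≤ L)
    (hmL : m ^ 2 * c₁ ≤ L * n) (htL : t * c₁ ≤ L * n) (hhL : h ^ 2 * c₂ ≤ L * n)
    (K : Fin n → Setoid Ω) (X Y : Fin q → Ω → Matrix (Fin n) (Fin n) F)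
    (hX : ∀ i v, Knows (K v) fun ω => X i ω v) (hY : ∀ i v, Knows (K v) fun ω => Y i ω v) :
    ∃ K', Evolves B (6 * (4 * (L * b))) K K' ∧
      ∀ i v, Knows (K' v) fun ω => (X i ω * Y i ω) v := by
  classical
  obtain ⟨a, b', l, hT⟩ := hT
  obtain ⟨e⟩ : Nonempty (Fin n ↪ Fin m × Fin h) :=
    Function.Embedding.nonempty_of_card_le (by simpa using hmh)
  -- The owner of `(i, x, y)` collects the entries at position `(x, y)` of all `m ^ 2` blocks of the
  -- `i`-th matrices, so it evaluates all linear forms at this position locally.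
  obtain ⟨own, hown⟩ := exists_balanced_map (T := Fin q × Fin h × Fin h) (n := n) (c := c₁)
    (by simpa [sq] using hc₁)
  -- The node responsible for `(i, μ)` multiplies the two `h × h` blocks given by the `μ`-th linear
  -- forms.
  obtain ⟨mul, hmul⟩ := exists_balanced_map (T := Fin q × Fin t) (n := n) (c := c₂)
    (by simpa using hc₂)
  -- entries of the matrices, held by the owners of the rows and of the positions inside the blocks
  let row : Fin q × Fin n × Fin n → Fin n := fun j => j.2.1
  let pos : Fin q × Fin n × Fin n → Fin n := fun j => own (j.1, (e j.2.1).2, (e j.2.2).2)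
  have hrow : ∀ u, (Finset.univ.filter fun j => row j = u).card ≤ L * n := by
    intro u
    have : (Finset.univ.filter fun j => row j = u) = Finset.univ ×ˢ {u} ×ˢ Finset.univ := by
      ext ⟨i, x, y⟩
      simp [row, eq_comm]
    rw [this]
    simpa using Nat.mul_le_mul_right n hqL
  have hpos : ∀ u, (Finset.univ.filter fun j => pos j = u).card ≤ L * n := by
    intro u
    refine (card_fiber_comp_le (fun j : Fin q × Fin n × Fin n => (j.1, (e j.2.1).2, (e j.2.2).2))
      own (d := m ^ 2) (fun x => ?_) hown u).trans hmL
    rw [sq]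
    conv_rhs => rw [← Fintype.card_fin m, ← Fintype.card_prod, ← Finset.card_univ]
    refine Finset.card_le_card_of_injOn (fun j => ((e j.2.1).1, (e j.2.2).1))
      (fun _ _ => Finset.mem_univ _) ?_
    rintro ⟨i, y, z⟩ hj ⟨i', y', z'⟩ hj' hjj
    simp only [Finset.coe_filter, Finset.mem_univ, true_and] at hj hj'
    have h₀ := Eq.trans hj (Eq.symm hj')
    simp only [Prod.mk.injEq] at h₀ hjj
    rw [h₀.1, e.injective (Prod.ext hjj.1 h₀.2.1), e.injective (Prod.ext hjj.2 h₀.2.2)]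
  -- entries of the products of blocks, held by the owners of positions and of products
  let pos' : Fin q × Fin t × Fin h × Fin h → Fin n := fun j => own (j.1, j.2.2)
  let prod' : Fin q × Fin t × Fin h × Fin h → Fin n := fun j => mul (j.1, j.2.1)
  have hpos' : ∀ u, (Finset.univ.filter fun j => pos' j = u).card ≤ L * n := by
    intro u
    refine (card_fiber_comp_le (fun j : Fin q × Fin t × Fin h × Fin h => (j.1, j.2.2))
      own (d := t) (fun x => ?_) hown u).trans htL
    conv_rhs => rw [← Fintype.card_fin t, ← Finset.card_univ]
    refine Finset.card_le_card_of_injOn (fun j => j.2.1) (fun _ _ => Finset.mem_univ _) ?_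
    rintro ⟨i, y, z⟩ hj ⟨i', y', z'⟩ hj' hjj
    simp only [Finset.coe_filter, Finset.mem_univ, true_and] at hj hj'
    have h₀ := Eq.trans hj (Eq.symm hj')
    simp only [Prod.mk.injEq] at h₀ hjj
    rw [h₀.1, h₀.2, hjj]
  have hprod' : ∀ u, (Finset.univ.filter fun j => prod' j = u).card ≤ L * n := by
    intro u
    refine (card_fiber_comp_le (fun j : Fin q × Fin t × Fin h × Fin h => (j.1, j.2.1))
      mul (d := h ^ 2) (fun x => ?_) hmul u).trans hhL
    rw [sq]
    conv_rhs => rw [← Fintype.card_fin h, ← Fintype.card_prod, ← Finset.card_univ]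
    refine Finset.card_le_card_of_injOn (fun j => j.2.2) (fun _ _ => Finset.mem_univ _) ?_
    rintro ⟨i, y, z⟩ hj ⟨i', y', z'⟩ hj' hjj
    simp only [Finset.coe_filter, Finset.mem_univ, true_and] at hj hj'
    have h₀ := Eq.trans hj (Eq.symm hj')
    simp only [Prod.mk.injEq] at h₀ hjj
    rw [h₀.1, h₀.2, hjj]
  obtain ⟨K₁, e₁, k₁⟩ := route hB hn hF K row pos L hrow hpos
    (fun j ω => X j.1 ω j.2.1 j.2.2) (fun j => (hX j.1 j.2.1).comp fun r => r j.2.2)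
  obtain ⟨K₂, e₂, k₂⟩ := route hB hn hF K₁ row pos L hrow hpos
    (fun j ω => Y j.1 ω j.2.1 j.2.2)
    (fun j => ((hY j.1 j.2.1).mono (e₁.le _)).comp fun r => r j.2.2)
  have hat : ∀ (K' : Fin n → Setoid Ω) (Z : Fin q → Ω → Matrix (Fin n) (Fin n) F),
      (∀ j, Knows (K' (pos j)) fun ω => Z j.1 ω j.2.1 j.2.2) → ∀ i x y z z',
      Knows (K' (own (i, x, y))) fun ω => (Z i ω).extendZero e (z, x) (z', y) := by
    intro K' Z hZ i x y z z'
    unfold Matrix.extendZero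
    by_cases hex : ∃ p : Fin n × Fin n, e p.1 = (z, x) ∧ e p.2 = (z', y)
    · simp only [dif_pos hex]
      have := hZ (i, hex.choose)
      simpa only [pos, hex.choose_spec.1, hex.choose_spec.2] using this
    · simp only [dif_neg hex]
      exact Knows.const _
  let S : (Fin m → Fin m → Fin t → F) → (Fin q → Ω → Matrix (Fin n) (Fin n) F) →
      Fin q × Fin t × Fin h × Fin h → Ω → F := fun a Z j ω =>
    ∑ p : Fin m × Fin m, a p.1 p.2 j.2.1 * (Z j.1 ω).extendZero e (p.1, j.2.2.1) (p.2, j.2.2.2)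
  have hS : ∀ (K' : Fin n → Setoid Ω) (a : Fin m → Fin m → Fin t → F)
      (Z : Fin q → Ω → Matrix (Fin n) (Fin n) F),
      (∀ j, Knows (K' (pos j)) fun ω => Z j.1 ω j.2.1 j.2.2) → ∀ j, Knows (K' (pos' j)) (S a Z j) :=
    fun K' a Z hZ j ω ω' hω => Finset.sum_congr rfl fun p _ => congrArg _
      (hat K' Z hZ j.1 j.2.2.1 j.2.2.2 p.1 p.2 ω ω' hω)
  obtain ⟨K₃, e₃, k₃⟩ := route hB hn hF K₂ pos' prod' L hpos' hprod' (S a X)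
    (hS K₂ a X fun j => (k₁ j).mono (e₂.le _))
  obtain ⟨K₄, e₄, k₄⟩ := route hB hn hF K₃ pos' prod' L hpos' hprod' (S b' Y)
    (fun j => (hS K₂ b' Y k₂ j).mono (e₃.le _))
  obtain ⟨K₅, e₅, k₅⟩ := route hB hn hF K₄ prod' pos' L hprod' hpos'
    (fun j ω => ∑ y, S a X (j.1, j.2.1, j.2.2.1, y) ω * S b' Y (j.1, j.2.1, y, j.2.2.2) ω)
    (fun j ω ω' hω => Finset.sum_congr rfl fun y _ => congrArg₂ _
      (k₃ (j.1, j.2.1, j.2.2.1, y) ω ω' (e₄.le _ hω)) (k₄ (j.1, j.2.1, y, j.2.2.2) ω ω' hω))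
  have hXY : ∀ j : Fin q × Fin n × Fin n, Knows (K₅ (pos j))
      fun ω => (X j.1 ω * Y j.1 ω) j.2.1 j.2.2 := by
    intro j ω ω' hω
    dsimp only
    rw [← Matrix.extendZero_mul_extendZero_apply e, ← Matrix.extendZero_mul_extendZero_apply e,
      ← Prod.mk.eta (p := e j.2.1), ← Prod.mk.eta (p := e j.2.2), hT.mul_apply, hT.mul_apply]
    exact Finset.sum_congr rfl fun μ _ => congrArg _
      (k₅ (j.1, μ, (e j.2.1).2, (e j.2.2).2) ω ω' hω)
  obtain ⟨K₆, e₆, k₆⟩ := route hB hn hF K₅ pos row L hpos hrow _ hXY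
  refine ⟨K₆, ?_, fun i v ω ω' hω => funext fun w => k₆ (i, v, w) ω ω' hω⟩
  convert ((((e₁.trans e₂).trans e₃).trans e₄).trans e₅).trans e₆ using 1
  ring

/-- The powers of a matrix, by repeated doubling. -/
theorem powers {F : Type} [Field F] {q R : ℕ}
    (hmul : ∀ (K : Fin n → Setoid Ω) (X Y : Fin (q + 1) → Ω → Matrix (Fin n) (Fin n) F),
      (∀ i v, Knows (K v) fun ω => X i ω v) → (∀ i v, Knows (K v) fun ω => Y i ω v) →
      ∃ K', Evolves B R K K' ∧ ∀ i v, Knows (K' v) fun ω => (X i ω * Y i ω) v)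
    (K : Fin n → Setoid Ω) (M : Ω → Matrix (Fin n) (Fin n) F)
    (hM : ∀ v, Knows (K v) fun ω => M ω v) :
    ∃ K', Evolves B (Nat.clog 2 q * R) K K' ∧ ∀ i ≤ q, ∀ v, Knows (K' v) fun ω => (M ω ^ i) v := by
  suffices H : ∀ s, ∃ K', Evolves B (s * R) K K' ∧
      ∀ i ≤ q, i ≤ 2 ^ s → ∀ v, Knows (K' v) fun ω => (M ω ^ i) v by
    obtain ⟨K', e, k⟩ := H (Nat.clog 2 q)
    exact ⟨K', e, fun i hi => k i hi (hi.trans (Nat.le_pow_clog one_lt_two q))⟩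
  intro s
  induction s with
  | zero =>
    refine ⟨K, by simpa using Evolves.refl K, fun i _ hi v => ?_⟩
    rw [pow_zero] at hi
    interval_cases i
    · simp only [pow_zero]
      exact Knows.const _
    · simpa only [pow_one] using hM v
  | succ s ih =>
    obtain ⟨K₁, e₁, k₁⟩ := ih
    -- Exponents beyond the current reach are padded with zero matrices, so that every doubling step
    -- is a full batch of `q + 1` products.
    have known : ∀ (f : ℕ → ℕ), (∀ i, f i ≤ i) → (∀ i ≤ 2 ^ (s + 1), f i ≤ 2 ^ s) →
        ∀ (i : Fin (q + 1)) v, Knows (K₁ v)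
        fun ω => (if (i : ℕ) ≤ 2 ^ (s + 1) then M ω ^ f i else 0) v := by
      intro f hf hf' i v
      by_cases hi : (i : ℕ) ≤ 2 ^ (s + 1)
      · simp only [if_pos hi]
        exact k₁ _ ((hf i).trans (Nat.lt_succ_iff.mp i.2)) (hf' i hi) v
      · simp only [if_neg hi]
        exact Knows.const _
    obtain ⟨K₂, e₂, k₂⟩ := hmul K₁
      (fun i ω => if (i : ℕ) ≤ 2 ^ (s + 1) then M ω ^ ((i : ℕ) / 2) else 0)
      (fun i ω => if (i : ℕ) ≤ 2 ^ (s + 1) then M ω ^ ((i : ℕ) - i / 2) else 0)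
      (known (fun i => i / 2) (fun i => Nat.div_le_self _ _) fun i hi => by
        rw [pow_succ] at hi
        omega)
      (known (fun i => i - i / 2) (fun i => Nat.sub_le _ _) fun i hi => by
        rw [pow_succ] at hi
        omega)
    refine ⟨K₂, by simpa only [Nat.succ_mul] using e₁.trans e₂, fun i hi hi' v => ?_⟩
    have := k₂ ⟨i, Nat.lt_succ_iff.mpr hi⟩ v
    simpa only [if_pos hi', ← pow_add, Nat.add_sub_of_le (Nat.div_le_self i 2)] using this

end Evolves

/-! ### Matchings and skew-symmetric matrices -/

/-- Each edge has exactly two ends among the matched vertices. It allows maximality to be measured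
by covered vertices, which is what degrees of polynomials see. -/
theorem SimpleGraph.Subgraph.IsMatching.ncard_verts {V : Type*} [Finite V] {G : SimpleGraph V}
    {M : G.Subgraph} (h : M.IsMatching) : M.verts.ncard = 2 * M.edgeSet.ncard := by
  classical
  have := Fintype.ofFinite V
  have hfib : ∀ e : M.edgeSet, Nat.card {v // h.toEdge v = e} = 2 := by
    rintro ⟨⟨u, v⟩, he⟩
    have huv : M.Adj u v := he
    have h₁ : {x | h.toEdge x = ⟨s(u, v), huv⟩} =
        ({⟨u, huv.fst_mem⟩, ⟨v, huv.snd_mem⟩} : Set M.verts) := h.toEdge_preimage_singleton huv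
    change Nat.card {x | h.toEdge x = ⟨s(u, v), huv⟩} = 2
    rw [h₁, Nat.card_coe_set_eq]
    exact Set.ncard_pair fun hne => huv.ne (congrArg Subtype.val hne)
  rw [← Nat.card_coe_set_eq, ← Nat.card_coe_set_eq, Nat.card_congr
    (Equiv.sigmaFiberEquiv h.toEdge).symm, Nat.card_sigma, Finset.sum_congr rfl fun e _ => hfib e]
  simp [mul_comm]

namespace SimpleGraph

variable {V : Type} [Finite V] (G : SimpleGraph V)

theorem exists_isMaximumMatching : ∃ M : G.Subgraph, G.IsMaximumMatching M := by
  have : Nonempty {M : G.Subgraph // M.IsMatching} := ⟨⟨⊥, fun v hv => hv.elim⟩⟩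
  obtain ⟨M, hM⟩ := Finite.exists_max fun M : {M : G.Subgraph // M.IsMatching} =>
    M.1.edgeSet.ncard
  exact ⟨M, M.2, fun M' h' => hM ⟨M', h'⟩⟩

variable {G}

theorem IsMaximumMatching.ncard_verts_le {M M' : G.Subgraph} (h : G.IsMaximumMatching M)
    (h' : M'.IsMatching) : M'.verts.ncard ≤ M.verts.ncard := by
  rw [h.1.ncard_verts, h'.ncard_verts]
  exact Nat.mul_le_mul_left _ (h.2 M' h')

/-- A matching that misses `v` and covers as many vertices as `M` would be maximum and put `v` into
`D(G)`. -/
theorem IsMaximumMatching.ncard_verts_lt {M M' : G.Subgraph} (h : G.IsMaximumMatching M)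
    (h' : M'.IsMatching) {v : V} (hv : v ∉ G.gallaiEdmondsD) (hvM : v ∉ M'.verts) :
    M'.verts.ncard < M.verts.ncard := by
  refine lt_of_le_of_ne (h.ncard_verts_le h') fun heq => hv ⟨M', ⟨h', fun M'' h'' => ?_⟩, hvM⟩
  rw [h.1.ncard_verts, h'.ncard_verts] at heq
  have := h.2 M'' h''
  omega

theorem IsMaximumMatching.exists_of_mem {M : G.Subgraph} (h : G.IsMaximumMatching M) {v : V}
    (hv : v ∈ G.gallaiEdmondsD) :
    ∃ M' : G.Subgraph, M'.IsMatching ∧ v ∉ M'.verts ∧ M'.verts.ncard = M.verts.ncard := by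
  obtain ⟨M', h', hv⟩ := hv
  exact ⟨M', h'.1, hv, le_antisymm (h.ncard_verts_le h'.1) (h'.ncard_verts_le h.1)⟩

end SimpleGraph

/-! ### Principal minors and the reversed characteristic polynomial. -/

namespace Matrix

open Polynomial

theorem dotProduct_mulVec_of_transpose_eq_neg {V R : Type*} [Fintype V] [CommRing R]
    {A : Matrix V V R} (hA : Aᵀ = -A) (x y : V → R) :
    x ⬝ᵥ (A *ᵥ y) = -(y ⬝ᵥ (A *ᵥ x)) := by
  rw [dotProduct_mulVec, ← mulVec_transpose, hA, neg_mulVec, neg_dotProduct, dotProduct_comm]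

variable {V R F : Type*} [Fintype V] [DecidableEq V] [CommRing R] [Field F]

/-- The matrix with the rows of `A` inside `S` and the rows of the identity outside of `S`; its
determinant is the principal minor of `A` given by `S`. -/
def principal (A : Matrix V V R) (S : Finset V) : Matrix V V R :=
  of fun i j => if i ∈ S then A i j else (1 : Matrix V V R) i j

theorem principal_mulVec_of_mem (A : Matrix V V R) {S : Finset V} {i : V} (hi : i ∈ S)
    (x : V → R) : (A.principal S *ᵥ x) i = (A *ᵥ x) i := by
  simp only [principal, mulVec, of_apply, if_pos hi]

theorem principal_mulVec_of_notMem (A : Matrix V V R) {S : Finset V} {i : V} (hi : i ∉ S)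
    (x : V → R) : (A.principal S *ᵥ x) i = x i := by
  conv_rhs => rw [← congrFun (one_mulVec x) i]
  simp only [principal, mulVec, of_apply, if_neg hi]

/-- The determinant is multilinear in the rows of `-X A + 1`: each row is taken from `-X A`, which
puts its index into `S`, or from the identity. -/
theorem charpolyRev_eq_sum_principal (A : Matrix V V R) :
    A.charpolyRev = ∑ S : Finset V, C ((-1) ^ S.card * (A.principal S).det) * X ^ S.card := by
  have h₁ : (1 - (X : R[X]) • A.map C : Matrix V V R[X]) =
      of (fun i => (-X : R[X]) • A.map C i) + 1 := by
    ext i j : 2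
    simp [sub_eq_add_neg, add_comm]
  have h₂ := (detRowAlternating (n := V) (R := R[X])).toMultilinearMap.map_add_univ
    (fun i => (-X : R[X]) • A.map C i) (1 : Matrix V V R[X])
  rw [charpolyRev, h₁]
  refine Eq.trans h₂ (Finset.sum_congr rfl fun S _ => ?_)
  let m : V → V → R[X] := (A.principal S).map C
  let one : V → V → R[X] := (1 : Matrix V V R[X])
  have h₃ : S.piecewise (fun i => (-X : R[X]) • (A.map C i : V → R[X])) one =
      S.piecewise (fun i => (-X : R[X]) • m i) m := by
    funext i j
    by_cases hi : i ∈ S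
    · have hm : m i j = C (A i j) := by simp [m, principal, hi]
      rw [Finset.piecewise_eq_of_mem _ _ _ hi, Finset.piecewise_eq_of_mem _ _ _ hi, Pi.smul_apply,
        Pi.smul_apply, hm, map_apply]
    · have hm : m i j = one i j := by
        simp [m, one, principal, hi, one_apply, apply_ite (C : R → R[X])]
      rw [Finset.piecewise_eq_of_notMem _ _ _ hi, Finset.piecewise_eq_of_notMem _ _ _ hi, hm]
  have h₄ := (detRowAlternating (n := V) (R := R[X])).toMultilinearMap.map_piecewise_smul
    (fun _ => (-X : R[X])) m S
  refine Eq.trans (congrArg _ h₃) (Eq.trans h₄ ?_)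
  have h₅ : detRowAlternating ((A.principal S).map (C : R →+* R[X])) = C (A.principal S).det := by
    rw [RingHom.map_det]
    rfl
  refine Eq.trans (congrArg _ h₅) ?_
  rw [Finset.prod_const, smul_eq_mul, neg_pow, C_mul, C_pow, C_neg, C_1]
  ring

theorem exists_principal_of_coeff_charpolyRev_ne_zero {A : Matrix V V R} {d : ℕ}
    (h : A.charpolyRev.coeff d ≠ 0) : ∃ S : Finset V, S.card = d ∧ (A.principal S).det ≠ 0 := by
  rw [charpolyRev_eq_sum_principal, finsetSum_coeff] at h
  obtain ⟨S, -, hS⟩ := Finset.exists_ne_zero_of_sum_ne_zero h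
  rw [coeff_C_mul, coeff_X_pow] at hS
  refine ⟨S, ?_, fun h0 => hS (by rw [h0]; simp)⟩
  by_contra hne
  exact hS (by rw [if_neg (Ne.symm hne), mul_zero])

theorem natDegree_charpolyRev_le (A : Matrix V V R) :
    A.charpolyRev.natDegree ≤ Fintype.card V := by
  refine natDegree_le_iff_coeff_eq_zero.mpr fun d hd => ?_
  by_contra h
  obtain ⟨S, rfl, -⟩ := exists_principal_of_coeff_charpolyRev_ne_zero h
  exact absurd (Finset.card_le_univ S) (not_le.mpr hd)

theorem principal_dotProduct {A : Matrix V V R} {S : Finset V} {x y : V → R}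
    (hx : ∀ i ∉ S, x i = 0) : x ⬝ᵥ (A.principal S *ᵥ y) = x ⬝ᵥ (A *ᵥ y) := by
  refine Finset.sum_congr rfl fun i _ => ?_
  by_cases hi : i ∈ S
  · rw [principal_mulVec_of_mem A hi]
  · rw [hx i hi, zero_mul, zero_mul]

/-- If a principal minor of a skew-symmetric matrix does not vanish, then some edge of the graph of
the matrix can be deleted with its two ends such that the remaining minor does not vanish. -/
theorem exists_principal_erase {A : Matrix V V F} (h2 : (2 : F) ≠ 0) (hA : Aᵀ = -A)
    {S : Finset V} (hS : (A.principal S).det ≠ 0) {i : V} (hi : i ∈ S) :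
    ∃ j ∈ S, A i j ≠ 0 ∧ (A.principal ((S.erase i).erase j)).det ≠ 0 := by
  have hsolve : ∀ b, ∃ y, A.principal S *ᵥ y = b := fun b =>
    ⟨(A.principal S)⁻¹ *ᵥ b, by
      rw [mulVec_mulVec, mul_nonsing_inv _ (isUnit_iff_ne_zero.mpr hS), one_mulVec]⟩
  have hsupp : ∀ k ∈ S, ∀ y, A.principal S *ᵥ y = Pi.single k 1 → ∀ i ∉ S, y i = 0 := by
    intro k hk y hy l hl
    rw [← principal_mulVec_of_notMem A hl y, hy, Pi.single_eq_of_ne]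
    rintro rfl
    exact hl hk
  have hpair : ∀ y z : V → F, (∀ i ∉ S, y i = 0) → (∀ i ∉ S, z i = 0) →
      y ⬝ᵥ (A.principal S *ᵥ z) = -(z ⬝ᵥ (A.principal S *ᵥ y)) := by
    intro y z hy hz
    rw [principal_dotProduct hy, principal_dotProduct hz, dotProduct_mulVec_of_transpose_eq_neg hA]
  obtain ⟨y, hy⟩ := hsolve (Pi.single i 1)
  have hyS := hsupp i hi y hy
  -- The form is alternating because 2 is invertible. In effect the inverse of the `S`-block has
  -- zero diagonal and entries `y j`, `-y j` at the two positions of `i`, `j`; its minor on `{i, j}`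
  -- is `y j ^ 2`, and Jacobi's identity for complementary minors explains the conclusion, which is
  -- verified directly below.
  have hyi : y i = 0 := by
    have h := hpair y y hyS hyS
    rw [hy, dotProduct_single_one] at h
    have : (2 : F) * y i = 0 := by linear_combination h
    exact (mul_eq_zero.mp this).resolve_left h2
  obtain ⟨j, hj⟩ : ∃ j, A i j * y j ≠ 0 := by
    by_contra! hcon
    have h := congrFun hy i
    rw [principal_mulVec_of_mem A hi, Pi.single_eq_same, mulVec, dotProduct,
      Finset.sum_eq_zero fun j _ => hcon j] at h
    exact zero_ne_one h
  have hyj : y j ≠ 0 := right_ne_zero_of_mul hj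
  have hjS : j ∈ S := by
    by_contra h
    exact hyj (hyS j h)
  have hji : j ≠ i := by
    rintro rfl
    exact hyj hyi
  obtain ⟨z, hz⟩ := hsolve (Pi.single j 1)
  have hzS := hsupp j hjS z hz
  have hzi : z i = -y j := by
    have h := hpair y z hyS hzS
    rw [hy, hz, dotProduct_single_one, dotProduct_single_one] at h
    rw [h, neg_neg]
  have hzj : z j = 0 := by
    have h := hpair z z hzS hzS
    rw [hz, dotProduct_single_one] at h
    have : (2 : F) * z j = 0 := by linear_combination h
    exact (mul_eq_zero.mp this).resolve_left h2
  refine ⟨j, hjS, left_ne_zero_of_mul hj, fun hdet => ?_⟩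
  obtain ⟨x, hx0, hx⟩ := exists_mulVec_eq_zero_iff.mpr hdet
  set S' := (S.erase i).erase j with hS'
  have hxS' : ∀ k ∉ S', x k = 0 := fun k hk => by
    rw [← principal_mulVec_of_notMem A hk x, hx, Pi.zero_apply]
  have hxS : ∀ k ∉ S, x k = 0 := fun k hk => hxS' k fun h =>
    hk (Finset.mem_of_mem_erase (Finset.mem_of_mem_erase h))
  have hxi : x i = 0 := hxS' i (by simp [hS'])
  have hxj : x j = 0 := hxS' j (by simp [hS'])
  -- A kernel vector for the smaller minor has an image supported on `{i, j}`. Pairing with `y` and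
  -- `z` kills both coordinates, so it lies in the kernel for `S`.
  have hAx : A.principal S *ᵥ x = Pi.single i ((A *ᵥ x) i) + Pi.single j ((A *ᵥ x) j) := by
    funext k
    rw [Pi.add_apply]
    by_cases hki : k = i
    · subst hki
      rw [principal_mulVec_of_mem A hi, Pi.single_eq_same, Pi.single_eq_of_ne hji.symm, add_zero]
    by_cases hkj : k = j
    · subst hkj
      rw [principal_mulVec_of_mem A hjS, Pi.single_eq_same, Pi.single_eq_of_ne hki, zero_add]
    rw [Pi.single_eq_of_ne hki, Pi.single_eq_of_ne hkj, add_zero]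
    by_cases hkS : k ∈ S
    · have hkS' : k ∈ S' := by simp [hS', hki, hkj, hkS]
      rw [principal_mulVec_of_mem A hkS, ← principal_mulVec_of_mem A hkS', hx, Pi.zero_apply]
    · rw [principal_mulVec_of_notMem A hkS, hxS k hkS]
  have hα : (A *ᵥ x) j = 0 := by
    have h := hpair y x hyS hxS
    rw [hAx, hy, dotProduct_add, dotProduct_single, dotProduct_single, dotProduct_single_one, hyi,
      hxi, zero_mul, zero_add, neg_zero] at h
    exact (mul_eq_zero.mp h).resolve_left hyj
  have hβ : (A *ᵥ x) i = 0 := by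
    have h := hpair z x hzS hxS
    rw [hAx, hz, dotProduct_add, dotProduct_single, dotProduct_single, dotProduct_single_one, hzj,
      hxj, zero_mul, add_zero, neg_zero, hzi] at h
    exact (mul_eq_zero.mp h).resolve_left (neg_ne_zero.mpr hyj)
  rw [hα, hβ, Pi.single_zero, Pi.single_zero, add_zero] at hAx
  exact hS (exists_mulVec_eq_zero_iff.mp ⟨x, hx0, hAx⟩)

/-- A nonvanishing principal minor of a skew-symmetric matrix supported on a graph gives a perfect
matching on its index set. -/
theorem exists_isMatching_of_principal_det_ne_zero {G : SimpleGraph V} {A : Matrix V V F}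
    (h2 : (2 : F) ≠ 0) (hA : Aᵀ = -A) (hG : ∀ i j, A i j ≠ 0 → G.Adj i j) (S : Finset V)
    (hS : (A.principal S).det ≠ 0) : ∃ M : G.Subgraph, M.IsMatching ∧ M.verts = S := by
  induction hk : S.card using Nat.strong_induction_on generalizing S with
  | _ k ih =>
    rcases S.eq_empty_or_nonempty with rfl | ⟨i, hi⟩
    · exact ⟨⊥, fun v hv => hv.elim, by simp⟩
    obtain ⟨j, hj, hij, hdet⟩ := exists_principal_erase h2 hA hS hi
    have hadj := hG i j hij
    have hji : j ∈ S.erase i := Finset.mem_erase.mpr ⟨hadj.ne', hj⟩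
    obtain ⟨M, hM, hMv⟩ := ih _ (by
      rw [← hk, Finset.card_erase_of_mem hji, Finset.card_erase_of_mem hi]
      have := Finset.card_pos.mpr ⟨i, hi⟩
      omega) _ hdet rfl
    have hM' := SimpleGraph.Subgraph.IsMatching.subgraphOfAdj hadj
    refine ⟨M ⊔ G.subgraphOfAdj hadj, hM.sup hM' ?_, ?_⟩
    · rw [hM.support_eq_verts, hM'.support_eq_verts, hMv, SimpleGraph.subgraphOfAdj_verts,
        Set.disjoint_left]
      intro x hx
      simp only [Finset.coe_erase, Set.mem_sdiff, Set.mem_singleton_iff, Finset.mem_coe] at hx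
      simp [hx.2, hx.1.2]
    · rw [SimpleGraph.Subgraph.verts_sup, hMv, SimpleGraph.subgraphOfAdj_verts]
      ext x
      simp only [Finset.coe_erase, Set.mem_union, Set.mem_sdiff, Set.mem_singleton_iff,
        Finset.mem_coe, Set.mem_insert_iff]
      by_cases hxi : x = i
      · simp [hxi, hi]
      · by_cases hxj : x = j
        · simp [hxj, hj]
        · simp [hxi, hxj]

/-- The generating function of the diagonal entries of the powers of `A`. -/
theorem charpolyRev_mul_mk_pow_apply (A : Matrix V V R) (v : V) :
    (A.charpolyRev : PowerSeries R) * PowerSeries.mk (fun m => (A ^ m) v v) =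
      ((A.updateRow v 0).charpolyRev : PowerSeries R) := by
  set P : Matrix V V R[X] := 1 - (X : R[X]) • A.map C with hP
  set Q : Matrix V V (PowerSeries R) := P.map (Polynomial.coeToPowerSeries.ringHom (R := R)) with hQ
  set T : Matrix V V (PowerSeries R) := of fun i j => PowerSeries.mk fun m => (A ^ m) i j with hT
  have hQapp : ∀ i j, Q i j = (if i = j then 1 else 0) - PowerSeries.X * PowerSeries.C (A i j) := by
    intro i j
    simp only [hQ, hP, map_apply, sub_apply, smul_apply, smul_eq_mul, one_apply, map_sub, map_mul,
      Polynomial.coeToPowerSeries.ringHom_apply, Polynomial.coe_X, Polynomial.coe_C]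
    split_ifs <;> simp
  -- The geometric series inverts `1 - X A` over power series.
  have hQT : Q * T = 1 := by
    ext i j m
    rw [mul_apply, map_sum]
    simp only [hQapp, sub_mul, ite_mul, one_mul, zero_mul, map_sub, mul_assoc]
    rw [Finset.sum_sub_distrib]
    rw [← map_sum, Finset.sum_ite_eq, if_pos (Finset.mem_univ _)]
    cases m with
    | zero => simp [hT, one_apply]
    | succ m =>
      simp only [PowerSeries.coeff_succ_X_mul, PowerSeries.coeff_C_mul]
      simp only [hT, of_apply, PowerSeries.coeff_mk]
      rw [pow_succ', mul_apply, sub_self, one_apply]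
      split_ifs <;> simp [PowerSeries.coeff_one]
  have hadj : Q.adjugate = Q.det • T := by
    calc Q.adjugate = Q.adjugate * (Q * T) := by rw [hQT, mul_one]
      _ = _ := by rw [← mul_assoc, adjugate_mul, smul_mul, one_mul]
  have hdet : Q.det = (A.charpolyRev : PowerSeries R) := by
    rw [hQ, ← RingHom.mapMatrix_apply, ← RingHom.map_det]
    rfl
  -- The diagonal cofactor of `1 - X A` at `v` is again a reversed characteristic polynomial, for
  -- `A` with row `v` zeroed.
  have hrow : P.updateRow v (Pi.single v 1) = 1 - (X : R[X]) • (A.updateRow v 0).map C := by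
    ext i j : 2
    by_cases hi : i = v
    · subst hi
      simp [one_apply, Pi.single_apply, eq_comm]
    · simp [hP, hi, one_apply]
  have hadj' : Q.adjugate = P.adjugate.map (Polynomial.coeToPowerSeries.ringHom (R := R)) :=
    (RingHom.map_adjugate _ P).symm
  have h := congrFun (congrFun hadj v) v
  rw [hadj', map_apply, adjugate_apply, hrow, hdet] at h
  exact h.symm

end Matrix

/-! ### The Gallai–Edmonds decomposition from the powers of a skew-symmetric matrix -/

namespace Matrix

open Polynomial

theorem charpolyRev_map {V R R' : Type*} [Fintype V] [DecidableEq V] [CommRing R] [CommRing R']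
    (A : Matrix V V R) (f : R →+* R') : (A.map f).charpolyRev = A.charpolyRev.map f := by
  rw [charpolyRev, charpolyRev, ← coe_mapRingHom, RingHom.map_det]
  congr 1
  ext i j : 2
  simp [one_apply, apply_ite (Polynomial.map f)]

theorem totalDegree_coeff_charpolyRev_le {V σ R : Type*} [Fintype V] [DecidableEq V] [CommRing R]
    {A : Matrix V V (MvPolynomial σ R)} (hA : ∀ i j, (A i j).totalDegree ≤ 1) (d : ℕ) :
    (A.charpolyRev.coeff d).totalDegree ≤ Fintype.card V := by
  rw [charpolyRev_eq_sum_principal, finsetSum_coeff]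
  refine MvPolynomial.totalDegree_finsetSum_le fun S _ => ?_
  rw [coeff_C_mul, coeff_X_pow]
  have hdet : (A.principal S).det.totalDegree ≤ Fintype.card V := by
    rw [det_apply]
    refine MvPolynomial.totalDegree_finsetSum_le fun π _ => ?_
    have hsign : ∀ (z : ℤˣ) (p : MvPolynomial σ R), (z • p).totalDegree ≤ p.totalDegree := by
      intro z p
      rcases Int.units_eq_one_or z with rfl | rfl <;> simp
    refine (hsign _ _).trans ((MvPolynomial.totalDegree_finsetProd _ _).trans ?_)
    refine (Finset.sum_le_card_nsmul _ _ 1 fun i _ => ?_).trans (by simp)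
    rw [principal, of_apply]
    split_ifs
    · exact hA _ _
    · rw [one_apply]
      split_ifs <;> simp
  split_ifs
  · rw [mul_one]
    rcases neg_one_pow_eq_or (MvPolynomial σ R) S.card with h | h <;> rw [h] <;> simpa using hdet
  · simp

end Matrix

/-! ### Recognizing strictly proper rational functions from finitely many coefficients. -/

/-- The sequence `s` agrees up to index `2 * n` with the coefficients of a rational function with a
denominator of degree at most `n` and a numerator of smaller degree. -/
def IsStrictlyProper {F : Type*} [Field F] (n : ℕ) (s : ℕ → F) : Prop :=
  ∃ N Q : Polynomial F, Q.natDegree ≤ n ∧ N.degree < Q.degree ∧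
    ∀ m ≤ 2 * n, PowerSeries.coeff m ((Q : PowerSeries F) * PowerSeries.mk s) = N.coeff m

theorem isStrictlyProper_congr {F : Type*} [Field F] {n : ℕ} {s s' : ℕ → F}
    (h : ∀ m ≤ 2 * n, s m = s' m) : IsStrictlyProper n s ↔ IsStrictlyProper n s' := by
  unfold IsStrictlyProper
  refine exists_congr fun N => exists_congr fun Q => and_congr_right fun _ =>
    and_congr_right fun _ => forall_congr' fun m => ?_
  refine imp_congr_right fun hm => ?_
  rw [PowerSeries.coeff_mul, PowerSeries.coeff_mul, Finset.sum_congr rfl fun p hp => ?_]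
  rw [PowerSeries.coeff_mk, PowerSeries.coeff_mk, h]
  have := Finset.HasAntidiagonal.mem_antidiagonal.mp hp
  omega

/-- Uniqueness of Padé approximants: any two representations satisfy `Q' * N = Q * N'`, so the
difference of the degrees of numerator and denominator does not depend on the representation. -/
theorem isStrictlyProper_iff {F : Type*} [Field F] {n : ℕ} {s : ℕ → F} {N Q : Polynomial F}
    (hQn : Q.natDegree ≤ n) (hNn : N.natDegree ≤ n) (hN : N ≠ 0) (hQ : Q ≠ 0)
    (h : (Q : PowerSeries F) * PowerSeries.mk s = (N : PowerSeries F)) :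
    IsStrictlyProper n s ↔ N.natDegree < Q.natDegree := by
  constructor
  · rintro ⟨N', Q', hQ'n, hdeg, hcoeff⟩
    have hQ' : Q' ≠ 0 := by
      rintro rfl
      simp at hdeg
    have hN'n : N'.natDegree ≤ n := (Polynomial.natDegree_le_natDegree hdeg.le).trans hQ'n
    -- Both sides have degree at most `2 * n`, and up to that index both coefficients are those of
    -- `Q * Q'` times the series.
    have heq : Q' * N = Q * N' := by
      ext m
      by_cases hm : m ≤ 2 * n
      · rw [← Polynomial.coeff_coe, ← Polynomial.coeff_coe, Polynomial.coe_mul, ← h,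
          mul_left_comm, PowerSeries.coeff_mul, Polynomial.coe_mul, PowerSeries.coeff_mul]
        refine Finset.sum_congr rfl fun p hp => ?_
        have := Finset.HasAntidiagonal.mem_antidiagonal.mp hp
        rw [hcoeff p.2 (by omega), Polynomial.coeff_coe N']
      · rw [Polynomial.coeff_eq_zero_of_natDegree_lt, Polynomial.coeff_eq_zero_of_natDegree_lt]
        · exact (Polynomial.natDegree_mul_le).trans_lt (by omega)
        · exact (Polynomial.natDegree_mul_le).trans_lt (by omega)
    have hN' : N' ≠ 0 := by
      rintro rfl
      rw [mul_zero] at heq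
      exact mul_ne_zero hQ' hN heq
    have h₁ := congrArg Polynomial.natDegree heq
    rw [Polynomial.natDegree_mul hQ' hN, Polynomial.natDegree_mul hQ hN'] at h₁
    have h₂ := Polynomial.natDegree_lt_natDegree hN' hdeg
    omega
  · intro hlt
    refine ⟨N, Q, hQn, Polynomial.degree_lt_degree hlt, fun m _ => ?_⟩
    rw [h, Polynomial.coeff_coe]

/-! ### Tutte matrices and their specializations at matchings. -/

namespace SimpleGraph

variable {V R F : Type} [LinearOrder V] [CommRing R] [Field F] (G : SimpleGraph V)

open scoped Classical in
/-- The Tutte matrix of `G` with the entries `a (i, j)` for the edges `ij` with `i < j`. -/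
noncomputable def tutteMatrix (a : V × V → R) : Matrix V V R :=
  Matrix.of fun i j => if G.Adj i j then (if i < j then a (i, j) else -a (j, i)) else 0

theorem tutteMatrix_transpose (a : V × V → R) : (G.tutteMatrix a).transpose = -G.tutteMatrix a := by
  ext i j
  simp only [tutteMatrix, Matrix.transpose_apply, Matrix.of_apply, Matrix.neg_apply]
  by_cases h : G.Adj i j
  · rcases lt_or_gt_of_ne h.ne with hlt | hlt
    · simp [h, h.symm, hlt, hlt.asymm]
    · simp [h, h.symm, hlt, hlt.asymm]
  · simp [h, G.adj_comm j i]

theorem tutteMatrix_map {R' : Type} [CommRing R'] (f : R →+* R') (a : V × V → R) :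
    (G.tutteMatrix a).map f = G.tutteMatrix fun q => f (a q) := by
  ext i j
  simp only [tutteMatrix, Matrix.map_apply, Matrix.of_apply]
  split_ifs <;> simp

variable {G}

open scoped Classical in
/-- The Tutte matrix of a matching, as a specialization of the one of the graph. -/
noncomputable def Subgraph.indicator (R : Type) [CommRing R] (M : G.Subgraph) : V × V → R :=
  fun q => if M.Adj q.1 q.2 then 1 else 0

open scoped Classical in
theorem tutteMatrix_indicator_apply (M : G.Subgraph) (i j : V) :
    G.tutteMatrix (M.indicator R) i j = if M.Adj i j then (if i < j then 1 else -1) else 0 := by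
  simp only [tutteMatrix, Subgraph.indicator, Matrix.of_apply, M.adj_comm j i]
  by_cases h : M.Adj i j
  · simp [h, h.adj_sub]
  · simp [h]

theorem tutteMatrix_indicator_updateRow {M : G.Subgraph} {v : V} (hv : v ∉ M.verts) :
    (G.tutteMatrix (M.indicator R)).updateRow v 0 = G.tutteMatrix (M.indicator R) := by
  classical
  ext i j
  by_cases hi : i = v
  · subst hi
    rw [Matrix.updateRow_self, tutteMatrix_indicator_apply, if_neg fun h => hv (M.edge_vert h),
      Pi.zero_apply]
  · rw [Matrix.updateRow_ne hi]

theorem adj_of_tutteMatrix_ne_zero {a : V × V → R} {i j : V} (h : G.tutteMatrix a i j ≠ 0) :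
    G.Adj i j := by
  by_contra hadj
  exact h (by simp [tutteMatrix, hadj])

variable [Fintype V]

open scoped Classical in
theorem tutteMatrix_indicator_mul_self {M : G.Subgraph} (hM : M.IsMatching) :
    G.tutteMatrix (M.indicator R) * G.tutteMatrix (M.indicator R) =
      Matrix.diagonal fun i => if i ∈ M.verts then -1 else 0 := by
  ext i k
  rw [Matrix.mul_apply]
  by_cases hi : i ∈ M.verts
  · obtain ⟨j, hj, huniq⟩ := hM hi
    rw [Finset.sum_eq_single j]
    · rw [tutteMatrix_indicator_apply, tutteMatrix_indicator_apply, if_pos hj]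
      by_cases hik : i = k
      · subst hik
        rw [if_pos hj.symm, Matrix.diagonal_apply_eq, if_pos hi]
        rcases lt_or_gt_of_ne hj.ne with h | h
        · simp [h, h.asymm]
        · simp [h, h.asymm]
      · have hjk : ¬ M.Adj j k := fun h => hik (hM.eq_of_adj_left hj.symm h)
        rw [Matrix.diagonal_apply_ne _ hik, if_neg hjk, mul_zero]
    · intro j' _ hj'
      rw [tutteMatrix_indicator_apply, if_neg fun h => hj' (huniq _ h), zero_mul]
    · simp
  · rw [Finset.sum_eq_zero fun j _ => ?_]
    · by_cases hik : i = k
      · subst hik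
        rw [Matrix.diagonal_apply_eq, if_neg hi]
      · rw [Matrix.diagonal_apply_ne _ hik]
    · rw [tutteMatrix_indicator_apply, if_neg fun h => hi (M.edge_vert h), zero_mul]

/-- Transposition gives `det (1 - X J) = det (1 + X J)`, and the product of the two is `det (1 - X ^
2 J ^ 2)`, which is `1 + X ^ 2` to the number of matched vertices, since `J ^ 2` is minus the
projection onto them. -/
theorem natDegree_charpolyRev_tutteMatrix_indicator {M : G.Subgraph} (hM : M.IsMatching) :
    (G.tutteMatrix (M.indicator F)).charpolyRev.natDegree = M.verts.ncard := by
  classical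
  set J := G.tutteMatrix (M.indicator F) with hJ
  have h₁ : (1 + (Polynomial.X : Polynomial F) • J.map Polynomial.C).det = J.charpolyRev := by
    rw [← Matrix.det_transpose, Matrix.transpose_add, Matrix.transpose_one, Matrix.transpose_smul,
      ← Matrix.transpose_map, hJ, tutteMatrix_transpose, Matrix.charpolyRev]
    congr 1
    ext i j : 2
    simp [sub_eq_add_neg]
  have h₂ : (1 - (Polynomial.X : Polynomial F) • J.map Polynomial.C) *
      (1 + (Polynomial.X : Polynomial F) • J.map Polynomial.C) =
      Matrix.diagonal fun i => if i ∈ M.verts then 1 + Polynomial.X ^ 2 else 1 := by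
    have h₃ : J.map Polynomial.C * J.map Polynomial.C =
        Matrix.diagonal fun i => if i ∈ M.verts then (-1 : Polynomial F) else 0 := by
      rw [← Matrix.map_mul, hJ, tutteMatrix_indicator_mul_self hM, Matrix.diagonal_map (by simp)]
      congr 1
      funext i
      split_ifs <;> simp [*]
    calc _ = 1 - (Polynomial.X : Polynomial F) ^ 2 • (J.map Polynomial.C * J.map Polynomial.C) := by
          rw [sub_mul, mul_add, mul_add, one_mul, one_mul, mul_one, Matrix.smul_mul,
            Matrix.mul_smul, smul_smul, sq]
          abel
      _ = _ := by
          rw [h₃]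
          ext i j : 2
          by_cases hij : i = j
          · subst hij
            by_cases hi : i ∈ M.verts <;> simp [hi]
          · simp [hij]
  have h₃ := congrArg Matrix.det h₂
  rw [Matrix.det_mul, h₁, ← Matrix.charpolyRev, Matrix.det_diagonal, ← sq] at h₃
  have h₄ := congrArg Polynomial.natDegree h₃
  rw [Finset.prod_ite, Finset.prod_const_one, mul_one, Finset.prod_const, Polynomial.natDegree_pow,
    Polynomial.natDegree_pow] at h₄
  have h₅ : (1 + Polynomial.X ^ 2 : Polynomial F).natDegree = 2 := by compute_degree!
  have h₆ : (Finset.univ.filter fun i => i ∈ M.verts).card = M.verts.ncard := by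
    rw [← Set.ncard_coe_finset]
    congr 1
    ext i
    simp
  rw [h₅, h₆] at h₄
  omega

theorem charpolyRev_ne_zero (A : Matrix V V F) : A.charpolyRev ≠ 0 := by
  intro h
  have := A.eval_charpolyRev
  rw [h, Polynomial.eval_zero] at this
  exact zero_ne_one this

theorem coeff_charpolyRev_tutteMatrix_indicator_ne_zero {M : G.Subgraph} (hM : M.IsMatching) :
    (G.tutteMatrix (M.indicator F)).charpolyRev.coeff M.verts.ncard ≠ 0 := by
  rw [← natDegree_charpolyRev_tutteMatrix_indicator (F := F) hM]
  exact Polynomial.leadingCoeff_ne_zero.mpr (charpolyRev_ne_zero _)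

theorem IsMaximumMatching.natDegree_charpolyRev_le (h2 : (2 : F) ≠ 0) {M : G.Subgraph}
    (hM : G.IsMaximumMatching M) (a : V × V → F) :
    (G.tutteMatrix a).charpolyRev.natDegree ≤ M.verts.ncard := by
  obtain ⟨S, hS, hdet⟩ := Matrix.exists_principal_of_coeff_charpolyRev_ne_zero
    (Polynomial.leadingCoeff_ne_zero.mpr (charpolyRev_ne_zero (G.tutteMatrix a)))
  obtain ⟨M', hM', hv⟩ := Matrix.exists_isMatching_of_principal_det_ne_zero h2
    (G.tutteMatrix_transpose a) (fun i j => adj_of_tutteMatrix_ne_zero) S hdet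
  have := hM.ncard_verts_le hM'
  rwa [hv, Set.ncard_coe_finset, hS] at this

/-- A nonvanishing minor cannot use the zero row `v`, so it yields a matching that misses `v`;
outside `D(G)` such a matching is not maximum. -/
theorem IsMaximumMatching.natDegree_charpolyRev_updateRow_lt (h2 : (2 : F) ≠ 0) {M : G.Subgraph}
    (hM : G.IsMaximumMatching M) (a : V × V → F) {v : V} (hv : v ∉ G.gallaiEdmondsD) :
    ((G.tutteMatrix a).updateRow v 0).charpolyRev.natDegree < M.verts.ncard := by
  obtain ⟨S, hS, hdet⟩ := Matrix.exists_principal_of_coeff_charpolyRev_ne_zero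
    (Polynomial.leadingCoeff_ne_zero.mpr
      (charpolyRev_ne_zero ((G.tutteMatrix a).updateRow v 0)))
  have hvS : v ∉ S := by
    intro hvS
    refine hdet (Matrix.det_eq_zero_of_row_eq_zero v fun j => ?_)
    simp [Matrix.principal, hvS]
  have heq : ((G.tutteMatrix a).updateRow v 0).principal S = (G.tutteMatrix a).principal S := by
    ext i j
    simp only [Matrix.principal, Matrix.of_apply]
    split_ifs with hi
    · rw [Matrix.updateRow_ne]
      rintro rfl
      exact hvS hi
    · rfl
  rw [heq] at hdet
  obtain ⟨M', hM', hv'⟩ := Matrix.exists_isMatching_of_principal_det_ne_zero h2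
    (G.tutteMatrix_transpose a) (fun i j => adj_of_tutteMatrix_ne_zero) S hdet
  have := hM.ncard_verts_lt hM' hv (by simpa [hv'] using hvS)
  rwa [hv', Set.ncard_coe_finset, hS] at this

/-- Generically, `v` belongs to `D(G)` if and only if the generating function of the diagonal
entries at `v` of the powers of the Tutte matrix is not strictly proper. -/
theorem IsMaximumMatching.mem_gallaiEdmondsD_iff (h2 : (2 : F) ≠ 0) {M : G.Subgraph}
    (hM : G.IsMaximumMatching M) (a : V × V → F)
    (h₀ : (G.tutteMatrix a).charpolyRev.coeff M.verts.ncard ≠ 0)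
    (hD : ∀ v ∈ G.gallaiEdmondsD,
      ((G.tutteMatrix a).updateRow v 0).charpolyRev.coeff M.verts.ncard ≠ 0) (v : V) :
    v ∈ G.gallaiEdmondsD ↔
      ¬ IsStrictlyProper (Fintype.card V) fun m => (G.tutteMatrix a ^ m) v v := by
  rw [isStrictlyProper_iff (Matrix.natDegree_charpolyRev_le _) (Matrix.natDegree_charpolyRev_le _)
    (charpolyRev_ne_zero _) (charpolyRev_ne_zero _) (Matrix.charpolyRev_mul_mk_pow_apply _ v),
    not_lt]
  constructor
  · exact fun hv => (hM.natDegree_charpolyRev_le h2 a).trans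
      (Polynomial.le_natDegree_of_ne_zero (hD v hv))
  · intro hle
    by_contra hv
    exact absurd ((Polynomial.le_natDegree_of_ne_zero h₀).trans hle)
      (not_le.mpr (hM.natDegree_charpolyRev_updateRow_lt h2 a hv))

end SimpleGraph

/-! ### Random entries -/

theorem MvPolynomial.card_zeros_mul_card_le {σ F : Type} [Fintype σ] [Field F] [Fintype F]
    {p : MvPolynomial σ F} (hp : p ≠ 0) {d : ℕ} (hd : p.totalDegree ≤ d) :
    Nat.card {a : σ → F // MvPolynomial.eval a p = 0} * Fintype.card F ≤
      d * Nat.card (σ → F) := by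
  classical
  let e := Fintype.equivFin σ
  have hp' : MvPolynomial.rename e p ≠ 0 := fun h =>
    hp (MvPolynomial.rename_injective e e.injective (by rw [h, map_zero]))
  have h := MvPolynomial.schwartz_zippel_totalDegree hp' Finset.univ
  have hcard : Nat.card {a : σ → F // MvPolynomial.eval a p = 0} =
      ((Fintype.piFinset fun _ : Fin (Fintype.card σ) => (Finset.univ : Finset F)).filter
        fun f => MvPolynomial.eval f (MvPolynomial.rename e p) = 0).card := by
    rw [Fintype.piFinset_univ, Nat.card_eq_fintype_card, ← Fintype.card_subtype]
    refine Fintype.card_congr ((Equiv.arrowCongr e (Equiv.refl F)).subtypeEquiv fun a => ?_)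
    rw [MvPolynomial.eval_rename]
    have : (Equiv.arrowCongr e (Equiv.refl F)) a ∘ e = a := by
      funext i
      simp
    rw [this]
  rw [← hcard, Finset.card_univ, div_le_div_iff₀ (pow_pos (by exact_mod_cast Fintype.card_pos) _)
    (by exact_mod_cast Fintype.card_pos)] at h
  have h' : Nat.card {a : σ → F // MvPolynomial.eval a p = 0} * Fintype.card F ≤
      (MvPolynomial.rename e p).totalDegree * Fintype.card F ^ Fintype.card σ := by
    exact_mod_cast h
  rw [Nat.card_fun, Nat.card_eq_fintype_card (α := F), Nat.card_eq_fintype_card (α := σ)]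
  exact h'.trans (Nat.mul_le_mul_right _ ((MvPolynomial.totalDegree_rename_le _ _).trans hd))

theorem MvPolynomial.card_exists_zero_mul_card_le {σ F ι : Type} [Fintype σ] [Field F] [Fintype F]
    [Fintype ι] {p : ι → MvPolynomial σ F} (hp : ∀ i, p i ≠ 0) {d : ℕ}
    (hd : ∀ i, (p i).totalDegree ≤ d) :
    Nat.card {a : σ → F // ∃ i, MvPolynomial.eval a (p i) = 0} * Fintype.card F ≤
      Fintype.card ι * d * Nat.card (σ → F) := by
  classical
  have h : Nat.card {a : σ → F // ∃ i, MvPolynomial.eval a (p i) = 0} ≤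
      ∑ i, Nat.card {a : σ → F // MvPolynomial.eval a (p i) = 0} := by
    simp only [Nat.card_eq_fintype_card, Fintype.card_subtype]
    refine (Finset.card_le_card ?_).trans Finset.card_biUnion_le
    intro a ha
    simpa using ha
  refine (Nat.mul_le_mul_right _ h).trans ?_
  rw [Finset.sum_mul, mul_assoc]
  refine (Finset.sum_le_card_nsmul _ _ _ fun i _ => card_zeros_mul_card_le (hp i) (hd i)).trans ?_
  simp

namespace SimpleGraph

variable {F : Type} [Field F] [Fintype F]

/-- With high probability, random entries of the Tutte matrix are generic. -/
theorem card_not_generic_le {V : Type} [LinearOrder V] [Fintype V] {G : SimpleGraph V}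
    (h2 : (2 : F) ≠ 0) :
    Nat.card {a : V × V → F // ¬ ∀ v, v ∈ G.gallaiEdmondsD ↔
      ¬ IsStrictlyProper (Fintype.card V) fun m => (G.tutteMatrix a ^ m) v v} * Fintype.card F ≤
      (Fintype.card V + 1) * Fintype.card V * Nat.card (V × V → F) := by
  classical
  obtain ⟨M, hM⟩ := G.exists_isMaximumMatching
  let A : Matrix V V (MvPolynomial (V × V) F) := G.tutteMatrix MvPolynomial.X
  have hAdeg : ∀ i j, (A i j).totalDegree ≤ 1 := by
    intro i j
    simp only [A, tutteMatrix, Matrix.of_apply]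
    split_ifs <;> simp
  have hAmap : ∀ a : V × V → F, A.map (MvPolynomial.eval a) = G.tutteMatrix a := by
    intro a
    simp only [A, tutteMatrix_map, MvPolynomial.eval_X]
  have hAmap' : ∀ (a : V × V → F) v, (A.updateRow v 0).map (MvPolynomial.eval a) =
      (G.tutteMatrix a).updateRow v 0 := by
    intro a v
    rw [Matrix.map_updateRow, hAmap]
    congr 1
  -- The polynomials whose nonvanishing means genericity: one for `G`, and one for each vertex of
  -- `D(G)`; the constant 1 is a filler elsewhere. The indicator of a maximum matching, missing `v`
  -- in the second case, is a point where they do not vanish.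
  let p : Option V → MvPolynomial (V × V) F := fun o => o.elim
    (A.charpolyRev.coeff M.verts.ncard) fun v =>
      if v ∈ G.gallaiEdmondsD then (A.updateRow v 0).charpolyRev.coeff M.verts.ncard else 1
  have hp₁ : ∀ a, MvPolynomial.eval a (A.charpolyRev.coeff M.verts.ncard) =
      (G.tutteMatrix a).charpolyRev.coeff M.verts.ncard := fun a => by
    rw [← hAmap, Matrix.charpolyRev_map, Polynomial.coeff_map]
  have hp₂ : ∀ a v, MvPolynomial.eval a ((A.updateRow v 0).charpolyRev.coeff M.verts.ncard) =
      ((G.tutteMatrix a).updateRow v 0).charpolyRev.coeff M.verts.ncard := fun a v => by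
    rw [← hAmap', Matrix.charpolyRev_map, Polynomial.coeff_map]
  have hp : ∀ o, p o ≠ 0 := by
    rintro (_ | v)
    · intro h
      have := hp₁ (M.indicator F)
      rw [show A.charpolyRev.coeff M.verts.ncard = 0 from h, map_zero] at this
      exact coeff_charpolyRev_tutteMatrix_indicator_ne_zero hM.1 this.symm
    · by_cases hv : v ∈ G.gallaiEdmondsD
      · obtain ⟨M', hM', hvM', hcard⟩ := hM.exists_of_mem hv
        intro h
        simp only [p, Option.elim, if_pos hv] at h
        have := hp₂ (M'.indicator F) v
        rw [h, map_zero, tutteMatrix_indicator_updateRow hvM', ← hcard] at this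
        exact coeff_charpolyRev_tutteMatrix_indicator_ne_zero hM' this.symm
      · simp [p, hv]
  have hd : ∀ o, (p o).totalDegree ≤ Fintype.card V := by
    rintro (_ | v)
    · exact Matrix.totalDegree_coeff_charpolyRev_le hAdeg _
    · simp only [p, Option.elim]
      split_ifs
      · refine Matrix.totalDegree_coeff_charpolyRev_le (fun i j => ?_) _
        by_cases hi : i = v
        · subst hi
          simp
        · rw [Matrix.updateRow_ne hi]
          exact hAdeg i j
      · simp
  have h := MvPolynomial.card_exists_zero_mul_card_le hp hd
  rw [Fintype.card_option] at h
  refine (Nat.mul_le_mul_right _ (Nat.card_le_card_of_injective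
    (Subtype.impEmbedding _ _ fun a ha => ?_) (Subtype.impEmbedding _ _ _).injective)).trans h
  by_contra hcon
  push Not at hcon
  refine ha (hM.mem_gallaiEdmondsD_iff h2 a ?_ fun v hv => ?_)
  · rw [← hp₁]
    exact hcon none
  · have := hcon (some v)
    simp only [p, Option.elim, if_pos hv] at this
    rwa [hp₂] at this

end SimpleGraph

/-! ### The protocol -/

/-- Lets a node that knows row `j` of a power of `A` know column `j` as well, without communication.
-/
theorem Matrix.pow_apply_of_transpose_eq_neg {V R : Type*} [Fintype V] [DecidableEq V] [CommRing R]
    {A : Matrix V V R} (hA : A.transpose = -A) (m : ℕ) (i j : V) :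
    (A ^ m) i j = (-1) ^ m * (A ^ m) j i := by
  have h : (A ^ m).transpose = (-1 : R) ^ m • A ^ m := by
    rw [Matrix.transpose_pow, hA, ← smul_pow, neg_one_smul]
  exact congrFun (congrFun h j) i

namespace Evolves

variable {n B : ℕ} {Ω : Type}

theorem card_filter_fst_le (u : Fin n) :
    (Finset.univ.filter fun j : Fin n × Fin n => j.1 = u).card ≤ 1 * n := by
  have : (Finset.univ.filter fun j : Fin n × Fin n => j.1 = u) = {u} ×ˢ Finset.univ := by
    ext ⟨x, y⟩
    simp [eq_comm]
  rw [this]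
  simp

theorem card_filter_snd_le (u : Fin n) :
    (Finset.univ.filter fun j : Fin n × Fin n => j.2 = u).card ≤ 1 * n := by
  have : (Finset.univ.filter fun j : Fin n × Fin n => j.2 = u) = Finset.univ ×ˢ {u} := by
    ext ⟨x, y⟩
    simp [eq_comm]
  rw [this]
  simp

/-- Every node tells all nodes whether it belongs to a set. -/
theorem broadcast_set (hB : 1 ≤ B) (hn : 0 < n) (K : Fin n → Setoid Ω) (S : Ω → Set (Fin n))
    (hS : ∀ u, Knows (K u) fun ω => u ∈ S ω) :
    ∃ K', Evolves B 4 K K' ∧ ∀ v, Knows (K' v) S := by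
  classical
  obtain ⟨K', e, k⟩ := route_bits (J := Fin n × Fin n) hB hn K Prod.fst Prod.snd 1
    card_filter_fst_le card_filter_snd_le (fun j ω => decide (j.1 ∈ S ω))
    (fun j ω ω' hω => decide_eq_decide.mpr (Eq.to_iff (hS j.1 ω ω' hω)))
  exact ⟨K', e, fun v ω ω' hω => Set.ext fun u => decide_eq_decide.mp (k (u, v) ω ω' hω)⟩

end Evolves

/-- The decomposition determined by its first part. -/
def SimpleGraph.decompositionOf {V : Type} (G : SimpleGraph V) (D : Set V) :
    Set V × Set V × Set V :=
  let K := {v | v ∉ D ∧ ∃ w ∈ D, G.Adj v w}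
  (D, K, (D ∪ K)ᶜ)

/-- The vertices that pass the test for `D(G)` on the powers of a Tutte matrix. -/
def SimpleGraph.candidates {n : ℕ} {F : Type} [Field F] (G : SimpleGraph (Fin n))
    (r : Fin n → Fin n → F) : Set (Fin n) :=
  {v | ¬ IsStrictlyProper n fun m => (G.tutteMatrix (fun q => r q.1 q.2) ^ m) v v}

theorem SimpleGraph.card_candidates_ne_le {n : ℕ} {F : Type} [Field F] [Fintype F]
    (h2 : (2 : F) ≠ 0) (G : SimpleGraph (Fin n)) :
    Nat.card {r : Fin n → Fin n → F // G.candidates r ≠ G.gallaiEdmondsD} * Fintype.card F ≤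
      (n + 1) * n * Nat.card (Fin n → Fin n → F) := by
  have h := card_not_generic_le (G := G) h2
  rw [Fintype.card_fin] at h
  rw [← Nat.card_congr (Equiv.curry (Fin n) (Fin n) F)]
  refine le_trans (le_of_eq ?_) h
  congr 1
  refine Nat.card_congr ((Equiv.curry (Fin n) (Fin n) F).symm.subtypeEquiv fun r => ?_)
  refine not_congr ?_
  rw [Set.ext_iff]
  refine forall_congr' fun v => ?_
  exact iff_comm

/-- The protocol, from a way of multiplying `q + 1` pairs of matrices in `R` rounds. -/
theorem exists_protocol_gallaiEdmonds {n B : ℕ} (hB : 1 ≤ B) (hn : 0 < n) {F : Type} [Field F]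
    [Fintype F] (h2 : (2 : F) ≠ 0) {b : ℕ} (hF : Fintype.card F ≤ 2 ^ b) {q R : ℕ}
    (hq : 2 * n ≤ q * q)
    (hmul : ∀ (K : Fin n → Setoid (SimpleGraph (Fin n) × (Fin n → Fin n → F)))
      (X Y : Fin (q + 1) → SimpleGraph (Fin n) × (Fin n → Fin n → F) → Matrix (Fin n) (Fin n) F),
      (∀ i v, Knows (K v) fun ω => X i ω v) → (∀ i v, Knows (K v) fun ω => Y i ω v) →
      ∃ K', Evolves B R K K' ∧ ∀ i v, Knows (K' v) fun ω => (X i ω * Y i ω) v) :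
    ∃ P : CliqueProtocol n B (Set (Fin n)) (Set (Fin n) × Set (Fin n) × Set (Fin n)),
      P.rounds = 4 * b + 2 * (Nat.clog 2 q * R) + 8 ∧
      ∀ G : SimpleGraph (Fin n), 1 - ((n + 1) * n : ℝ) / Fintype.card F ≤
        P.successProb (fun v => G.neighborSet v) fun out => ∀ v, out v = G.gallaiEdmonds := by
  classical
  let K₀ : Fin n → Setoid (SimpleGraph (Fin n) × (Fin n → Fin n → F)) := fun v =>
    Setoid.ker fun ω => (ω.1.neighborSet v, ω.2 v)
  have kG : ∀ v, Knows (K₀ v) fun ω => ω.1.neighborSet v := fun v ω ω' hω =>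
    congrArg Prod.fst (show (ω.1.neighborSet v, ω.2 v) = (ω'.1.neighborSet v, ω'.2 v) from hω)
  have kr : ∀ v, Knows (K₀ v) fun ω => ω.2 v := fun v ω ω' hω =>
    congrArg Prod.snd (show (ω.1.neighborSet v, ω.2 v) = (ω'.1.neighborSet v, ω'.2 v) from hω)
  let A : SimpleGraph (Fin n) × (Fin n → Fin n → F) → Matrix (Fin n) (Fin n) F := fun ω =>
    ω.1.tutteMatrix fun p => ω.2 p.1 p.2
  have hA : ∀ ω, (A ω).transpose = -A ω := fun ω => ω.1.tutteMatrix_transpose _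
  -- The entry for an edge is drawn by its smaller end; exchanging all draws gives every node its
  -- row of the Tutte matrix.
  obtain ⟨K₁, e₁, k₁⟩ := Evolves.route (J := Fin n × Fin n) hB hn hF K₀ Prod.fst Prod.snd 1
    Evolves.card_filter_fst_le Evolves.card_filter_snd_le (fun j ω => ω.2 j.1 j.2)
    (fun j => (kr j.1).comp fun r => r j.2)
  have kA : ∀ v, Knows (K₁ v) fun ω => A ω v := by
    intro v ω ω' hω
    have hadj : ∀ w, ω.1.Adj v w = ω'.1.Adj v w := fun w =>
      congrFun (congrArg (fun (S : Set (Fin n)) x => x ∈ S) (kG v ω ω' (e₁.le v hω))) w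
    funext w
    simp only [A, SimpleGraph.tutteMatrix, Matrix.of_apply, hadj w]
    have h₁ : ω.2 v w = ω'.2 v w := congrFun (kr v ω ω' (e₁.le v hω)) w
    have h₂ : ω.2 w v = ω'.2 w v := k₁ (w, v) ω ω' hω
    rw [h₁, h₂]
  obtain ⟨K₂, e₂, k₂⟩ := Evolves.powers hmul K₁ A kA
  -- Giant steps: the powers of `A ^ q`.
  obtain ⟨K₃, e₃, k₃⟩ := Evolves.powers hmul K₂ (fun ω => A ω ^ q) (k₂ q le_rfl)
  have hseq : ∀ m ≤ 2 * n, ∀ v, Knows (K₃ v) fun ω => (A ω ^ m) v v := by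
    intro m hm v ω ω' hω
    have hq0 : 0 < q := Nat.pos_of_ne_zero fun h => by subst h; omega
    have hmod : m % q ≤ q := (Nat.mod_lt m hq0).le
    have hdiv : m / q ≤ q := Nat.div_le_of_le_mul (hm.trans hq)
    -- Writing `m = m % q + q * (m / q)`, the diagonal entry becomes a signed product of two rows
    -- held by `v`; no further matrix product is needed.
    have hexp : ∀ ω, (A ω ^ m) v v = ∑ u, (A ω ^ (m % q)) v u *
        ((-1) ^ (q * (m / q)) * ((A ω ^ q) ^ (m / q)) v u) := by
      intro ω
      conv_lhs => rw [← Nat.mod_add_div m q]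
      rw [pow_add, Matrix.mul_apply]
      refine Finset.sum_congr rfl fun u _ => ?_
      rw [Matrix.pow_apply_of_transpose_eq_neg (hA ω) (q * (m / q)) u v, pow_mul (A ω)]
    have h₁ : (A ω ^ (m % q)) v = (A ω' ^ (m % q)) v := k₂ _ hmod v ω ω' (e₃.le v hω)
    have h₂ : ((A ω ^ q) ^ (m / q)) v = ((A ω' ^ q) ^ (m / q)) v := k₃ _ hdiv v ω ω' hω
    dsimp only
    rw [hexp, hexp, h₁, h₂]
  let D : SimpleGraph (Fin n) × (Fin n → Fin n → F) → Set (Fin n) := fun ω => ω.1.candidates ω.2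
  have kD : ∀ u, Knows (K₃ u) fun ω => u ∈ D ω := fun u ω ω' hω =>
    propext (not_congr (isStrictlyProper_congr fun m hm => hseq m hm u ω ω' hω))
  -- Once `D` is public, each node decides from its own neighbours whether it lies in `K(G)`; a
  -- second broadcast makes that public too.
  obtain ⟨K₄, e₄, k₄⟩ := Evolves.broadcast_set hB hn K₃ D kD
  have kG' : ∀ v, Knows (K₄ v) fun ω => ω.1.neighborSet v := fun v =>
    (kG v).mono ((e₄.le v).trans ((e₃.le v).trans ((e₂.le v).trans (e₁.le v))))
  let N : SimpleGraph (Fin n) × (Fin n → Fin n → F) → Set (Fin n) := fun ω =>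
    {v | v ∉ D ω ∧ ∃ w ∈ D ω, ω.1.Adj v w}
  have kN : ∀ u, Knows (K₄ u) fun ω => u ∈ N ω := by
    intro u ω ω' hω
    have hadj : ∀ w, ω.1.Adj u w = ω'.1.Adj u w := fun w =>
      congrFun (congrArg (fun (S : Set (Fin n)) x => x ∈ S) (kG' u ω ω' hω)) w
    change (u ∉ D ω ∧ ∃ w ∈ D ω, ω.1.Adj u w) = (u ∉ D ω' ∧ ∃ w ∈ D ω', ω'.1.Adj u w)
    simp only [hadj, show D ω = D ω' from k₄ u ω ω' hω]
  obtain ⟨K₅, e₅, k₅⟩ := Evolves.broadcast_set hB hn K₄ N kN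
  obtain ⟨P, hP, hprob⟩ := Evolves.exists_protocol (fun (G : SimpleGraph (Fin n)) v =>
    G.neighborSet v) ((((e₁.trans e₂).trans e₃).trans e₄).trans e₅)
    (fun _ ω => ω.1.decompositionOf (D ω)) (fun v ω ω' hω => by
      change (D ω, N ω, (D ω ∪ N ω)ᶜ) = (D ω', N ω', (D ω' ∪ N ω')ᶜ)
      rw [show D ω = D ω' from k₄ v ω ω' (e₅.le v hω), show N ω = N ω' from k₅ v ω ω' hω])
  refine ⟨P, by rw [hP]; ring, fun G => ?_⟩
  rw [hprob]
  have hbad := G.card_candidates_ne_le h2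
  have hgood : Nat.card {r : Fin n → Fin n → F // G.candidates r = G.gallaiEdmondsD} ≤
      Nat.card {r : Fin n → Fin n → F // ∀ _ : Fin n,
        G.decompositionOf (D (G, r)) = G.gallaiEdmonds} := by
    refine Nat.card_le_card_of_injective (Subtype.impEmbedding _ _ fun r hr _ => ?_)
      (Subtype.impEmbedding _ _ _).injective
    change G.decompositionOf (G.candidates r) = _
    rw [hr]
    rfl
  have hsum : Nat.card {r : Fin n → Fin n → F // G.candidates r = G.gallaiEdmondsD} +
      Nat.card {r : Fin n → Fin n → F // G.candidates r ≠ G.gallaiEdmondsD} =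
      Nat.card (Fin n → Fin n → F) := by
    rw [← Nat.card_sum]
    exact Nat.card_congr (Equiv.sumCompl _)
  have hT : (0 : ℝ) < Nat.card (Fin n → Fin n → F) := by exact_mod_cast Nat.card_pos
  have hc : (0 : ℝ) < Fintype.card F := by exact_mod_cast Fintype.card_pos
  rw [le_div_iff₀ hT, sub_mul, one_mul, sub_le_iff_le_add]
  have h₁ : (Nat.card {r : Fin n → Fin n → F // G.candidates r ≠ G.gallaiEdmondsD} : ℝ) ≤
      ((n + 1) * n : ℝ) / Fintype.card F * Nat.card (Fin n → Fin n → F) := by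
    rw [div_mul_eq_mul_div, le_div_iff₀ hc]
    exact_mod_cast hbad
  have h₂ : (Nat.card (Fin n → Fin n → F) : ℝ) =
      Nat.card {r : Fin n → Fin n → F // G.candidates r = G.gallaiEdmondsD} +
      Nat.card {r : Fin n → Fin n → F // G.candidates r ≠ G.gallaiEdmondsD} := by
    exact_mod_cast hsum.symm
  have h₃ : (Nat.card {r : Fin n → Fin n → F // G.candidates r = G.gallaiEdmondsD} : ℝ) ≤
      Nat.card {r : Fin n → Fin n → F // ∀ _ : Fin n,
        G.decompositionOf (D (G, r)) = G.gallaiEdmonds} := by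
    exact_mod_cast hgood
  linarith

/-! ### The exponent of matrix multiplication -/

theorem HasMatMulTensor.hasBilinearAlgorithm {K : Type} [Field K] {m t : ℕ}
    (h : HasMatMulTensor K m t) : HasBilinearAlgorithm K m t := by
  obtain ⟨a, b, l, h⟩ := h
  refine ⟨a, fun i j => b j i, l, fun A B i j => ?_⟩
  have h₁ := h.mul_apply (κ := Unit) (A.submatrix Prod.fst Prod.fst)
    (B.submatrix Prod.fst Prod.fst) i j () ()
  have h₂ : (A.submatrix Prod.fst Prod.fst * B.submatrix Prod.fst Prod.fst :
      Matrix (Fin m × Unit) (Fin m × Unit) K) (i, ()) (j, ()) = (A * B) i j := by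
    simp [Matrix.mul_apply, Fintype.sum_prod_type]
  rw [← h₂, h₁]
  refine Finset.sum_congr rfl fun μ _ => ?_
  simp only [Finset.univ_unique, Finset.sum_singleton, Matrix.submatrix_apply,
    Fintype.sum_prod_type, mul_assoc]
  congr 2
  exact Finset.sum_comm

theorem matMulExponent_set_nonempty (K : Type) [Field K] :
    {τ : ℝ | ∀ ε : ℝ, 0 < ε → ∃ C : ℝ, ∀ n : ℕ, 1 ≤ n →
      ∃ t : ℕ, (t : ℝ) ≤ C * (n : ℝ) ^ (τ + ε) ∧ HasBilinearAlgorithm K n t}.Nonempty := by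
  refine ⟨3, fun ε hε => ⟨1, fun n hn => ⟨n ^ 3, ?_,
    (HasMatMulTensor.naive K n).hasBilinearAlgorithm⟩⟩⟩
  have hn' : (1 : ℝ) ≤ n := by exact_mod_cast hn
  rw [one_mul, Nat.cast_pow, ← Real.rpow_natCast]
  exact Real.rpow_le_rpow_of_exponent_le hn' (by norm_num; exact hε.le)

theorem two_le_of_rank_bound {K : Type} [Field K] {τ : ℝ} (h : ∀ ε : ℝ, 0 < ε → ∃ C : ℝ, ∀ n : ℕ,
    1 ≤ n → ∃ t : ℕ, (t : ℝ) ≤ C * (n : ℝ) ^ (τ + ε) ∧ HasBilinearAlgorithm K n t) : 2 ≤ τ := by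
  by_contra! hτ
  obtain ⟨C, hC⟩ := h ((2 - τ) / 2) (by linarith)
  have hlim := (tendsto_rpow_atTop (y := (2 - τ) / 2) (by linarith)).comp
    tendsto_natCast_atTop_atTop
  obtain ⟨n, hn1, hn⟩ := ((Filter.eventually_ge_atTop 1).and
    (hlim.eventually_gt_atTop C)).exists
  obtain ⟨t, ht, hbil⟩ := hC n hn1
  have h₁ : ((n ^ 2 : ℕ) : ℝ) ≤ t := by exact_mod_cast hbil.hasMatMulTensor.sq_le
  have hpos : (0 : ℝ) < n := by exact_mod_cast hn1
  have h₂ : ((n ^ 2 : ℕ) : ℝ) = (n : ℝ) ^ ((2 - τ) / 2) * (n : ℝ) ^ (τ + (2 - τ) / 2) := by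
    rw [← Real.rpow_add hpos, Nat.cast_pow, ← Real.rpow_natCast]
    congr 1
    push_cast
    ring
  have h₃ := mul_lt_mul_of_pos_right hn (Real.rpow_pos_of_pos hpos (τ + (2 - τ) / 2))
  simp only [Function.comp_apply] at h₃
  linarith

theorem two_le_matMulExponent (K : Type) [Field K] : 2 ≤ matMulExponent K :=
  le_csInf (matMulExponent_set_nonempty K) fun _ h => two_le_of_rank_bound h

/-- The format is taken so large that `m ^ (δ / 3)` absorbs the implied constant, so tensor powers
of this single tensor obey the same bound with constant 1. -/
theorem exists_hasMatMulTensor_rank_le (K : Type) [Field K] {δ : ℝ} (hδ : 0 < δ) :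
    ∃ m t : ℕ, 2 ≤ m ∧ HasMatMulTensor K m t ∧ (t : ℝ) ≤ (m : ℝ) ^ (matMulExponent K + δ) := by
  obtain ⟨τ, hτ, hlt⟩ := exists_lt_of_csInf_lt (matMulExponent_set_nonempty K)
    (show sInf _ < matMulExponent K + δ / 3 from lt_add_of_pos_right _ (by positivity))
  obtain ⟨C, hC⟩ := hτ (δ / 3) (by positivity)
  have hlim := (tendsto_rpow_atTop (y := δ / 3) (by positivity)).comp
    tendsto_natCast_atTop_atTop
  obtain ⟨m, hm, hCm⟩ := ((Filter.eventually_ge_atTop 2).and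
    (hlim.eventually_ge_atTop C)).exists
  obtain ⟨t, ht, hbil⟩ := hC m (by omega)
  refine ⟨m, t, hm, hbil.hasMatMulTensor, ht.trans ?_⟩
  have hm1 : (1 : ℝ) ≤ m := by exact_mod_cast (by omega : 1 ≤ m)
  calc C * (m : ℝ) ^ (τ + δ / 3) ≤ (m : ℝ) ^ (δ / 3) * (m : ℝ) ^ (τ + δ / 3) :=
        mul_le_mul_of_nonneg_right hCm (by positivity)
    _ = (m : ℝ) ^ (δ / 3 + (τ + δ / 3)) := (Real.rpow_add (by linarith) _ _).symm
    _ ≤ _ := Real.rpow_le_rpow_of_exponent_le hm1 (by linarith)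

/-! ### Choice of the parameters -/

theorem sq_div_le_rpow {β : ℝ} (hβ : 2 ≤ β) {n m h t t₀ : ℕ} (hn : 1 ≤ n) (hm1 : 1 ≤ m)
    (ht₀ : 1 ≤ t₀) (hmβ : (t : ℝ) ≤ (m : ℝ) ^ β) (hroot : n ≤ (2 * t₀ * t) ^ 2)
    (hmh : m * h ≤ 2 * n) : (h : ℝ) ^ 2 / n ≤ 8 * t₀ * (n : ℝ) ^ (1 - 1 / β) := by
  have hn0 : (0 : ℝ) < n := by exact_mod_cast hn
  have hβ0 : 0 < β := by linarith
  have hm0 : (0 : ℝ) < m := by exact_mod_cast hm1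
  have ht₀' : (1 : ℝ) ≤ t₀ := by exact_mod_cast ht₀
  -- Since `t` is within a constant factor of `√n` and `t ≤ m ^ β`, the number `m ^ 2` of blocks is
  -- at least of order `n ^ (1 / β)`.
  have hblocks : (n : ℝ) ^ (1 / β) ≤ 2 * t₀ * (m : ℝ) ^ 2 := by
    have h₁ : (n : ℝ) ≤ (2 * t₀ * (m : ℝ) ^ 2) ^ β := by
      calc (n : ℝ) ≤ (2 * t₀) ^ 2 * (t : ℝ) ^ 2 := by
            rw [← mul_pow]
            exact_mod_cast hroot
        _ ≤ (2 * t₀ : ℝ) ^ β * ((m : ℝ) ^ β) ^ 2 := by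
            refine mul_le_mul ?_ (pow_le_pow_left₀ (by positivity) hmβ 2) (by positivity)
              (by positivity)
            rw [← Real.rpow_two]
            exact Real.rpow_le_rpow_of_exponent_le (by linarith) hβ
        _ = (2 * t₀ * (m : ℝ) ^ 2) ^ β := by
            have h₂ : ((m : ℝ) ^ β) ^ 2 = ((m : ℝ) ^ 2) ^ β := by
              rw [← Real.rpow_two, ← Real.rpow_two, ← Real.rpow_mul hm0.le,
                ← Real.rpow_mul hm0.le, mul_comm]
            rw [h₂, ← Real.mul_rpow (by positivity) (by positivity)]
    calc (n : ℝ) ^ (1 / β) ≤ ((2 * t₀ * (m : ℝ) ^ 2) ^ β) ^ (1 / β) :=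
          Real.rpow_le_rpow hn0.le h₁ (by positivity)
      _ = _ := by
          rw [← Real.rpow_mul (by positivity), mul_one_div_cancel hβ0.ne', Real.rpow_one]
  have hexp : (n : ℝ) ^ (1 - 1 / β) * (n : ℝ) ^ (1 / β) = n := by
    rw [← Real.rpow_add hn0, sub_add_cancel, Real.rpow_one]
  rw [div_le_iff₀ hn0]
  refine le_of_mul_le_mul_right ?_ (show (0 : ℝ) < (m : ℝ) ^ 2 by positivity)
  have h₁ : ((m : ℝ) * h) ^ 2 ≤ (2 * n) ^ 2 :=
    pow_le_pow_left₀ (by positivity) (by exact_mod_cast hmh) 2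
  have h₂ := mul_le_mul_of_nonneg_left hblocks
    (show (0 : ℝ) ≤ (n : ℝ) ^ (1 - 1 / β) by positivity)
  rw [hexp] at h₂
  calc (h : ℝ) ^ 2 * (m : ℝ) ^ 2 = ((m : ℝ) * h) ^ 2 := by ring
    _ ≤ 4 * (n : ℝ) * n := by linarith [h₁]
    _ ≤ 4 * (n : ℝ) * ((n : ℝ) ^ (1 - 1 / β) * (2 * t₀ * (m : ℝ) ^ 2)) := by gcongr
    _ = _ := by ring

/-- From a tensor of format `m₀` and rank `t₀`, the sizes for multiplying `2 √n + 3` pairs of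
`n × n` matrices. -/
theorem exists_batch_parameters {K : Type} [Field K] {m₀ t₀ : ℕ} (hm₀ : 2 ≤ m₀)
    (hT : HasMatMulTensor K m₀ t₀) {β : ℝ} (hβ : 2 ≤ β) (ht₀ : (t₀ : ℝ) ≤ (m₀ : ℝ) ^ β) {n : ℕ}
    (hn : 1 ≤ n) :
    ∃ m t h c₁ c₂ L : ℕ, HasMatMulTensor K m t ∧ n ≤ m * h ∧
      (2 * (Nat.sqrt n + 1) + 1) * h ^ 2 ≤ n * c₁ ∧ (2 * (Nat.sqrt n + 1) + 1) * t ≤ n * c₂ ∧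
      2 * (Nat.sqrt n + 1) + 1 ≤ L ∧ m ^ 2 * c₁ ≤ L * n ∧ t * c₁ ≤ L * n ∧ h ^ 2 * c₂ ≤ L * n ∧
      (L : ℝ) ≤ (23 + 40 * t₀) * (n : ℝ) ^ (1 - 1 / β) := by
  set s := Nat.sqrt n with hs
  have hs1 : 1 ≤ s := Nat.sqrt_pos.mpr hn
  have hsn : s * s ≤ n := Nat.sqrt_le n
  have hsn' : s ≤ n := Nat.sqrt_le_self n
  have hns : n < (s + 1) * (s + 1) := Nat.lt_succ_sqrt n
  set Q := 2 * (s + 1) + 1 with hQ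
  have hQs : Q ≤ 5 * s := by omega
  have ht₀2 : 1 < t₀ := by
    have := hT.sq_le
    nlinarith
  -- The largest tensor power of rank at most `√n`. Then `Q * t ≤ 5 * n`, which is the reason for
  -- `c₂ = 5` below.
  set r := Nat.log t₀ s with hr
  have hts : t₀ ^ r ≤ s := Nat.pow_log_le_self t₀ (by omega)
  have hst : s < t₀ ^ r * t₀ := Nat.lt_pow_succ_log_self ht₀2 s
  have hTr := hT.pow r
  set t := t₀ ^ r with ht
  set m := m₀ ^ r with hm
  have hmt : m ^ 2 ≤ t := hTr.sq_le
  have hm1 : 1 ≤ m := Nat.one_le_pow _ _ (by omega)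
  have hmn : m ^ 2 ≤ n := (hmt.trans hts).trans hsn'
  set h := n / m + 1 with hh
  have hmh : n ≤ m * h := (Nat.lt_mul_div_succ n hm1).le
  have hmh2 : m * h ≤ 2 * n := by
    have := Nat.mul_div_le n m
    have := Nat.le_self_pow two_ne_zero m
    rw [hh, mul_add]
    omega
  set c₁ := Q * h ^ 2 / n + 1 with hc₁
  have hc₁n : c₁ * n ≤ Q * h ^ 2 + n := by
    have := Nat.div_mul_le_self (Q * h ^ 2) n
    rw [hc₁, add_mul]
    omega
  obtain ⟨e, he⟩ : ∃ e, e = 5 * h ^ 2 / n := ⟨_, rfl⟩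
  -- The part `4 * Q + 1` pays for the exchange of matrix entries, using `m * h ≤ 2 * n`; the part
  -- `e + 2` pays for the exchange of blocks.
  set L := 4 * Q + 1 + (e + 2) with hL
  have hLn : 5 * h ^ 2 + n ≤ L * n := by
    have h₁ : 5 * h ^ 2 < n * (e + 1) := he ▸ Nat.lt_mul_div_succ _ hn
    rw [hL]
    nlinarith
  have hc₁Q : Q * h ^ 2 ≤ n * c₁ := (Nat.lt_mul_div_succ _ hn).le
  clear_value L c₁ h m t r Q s
  refine ⟨m, t, h, c₁, 5, L, hTr, hmh, hc₁Q, ?_, by omega, ?_, ?_, ?_, ?_⟩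
  · calc Q * t ≤ 5 * s * s := Nat.mul_le_mul hQs hts
      _ = s * s * 5 := by ring
      _ ≤ n * 5 := Nat.mul_le_mul_right _ hsn
  · refine Nat.le_of_mul_le_mul_right (c := n) ?_ hn
    calc m ^ 2 * c₁ * n = m ^ 2 * (c₁ * n) := by ring
      _ ≤ m ^ 2 * (Q * h ^ 2 + n) := Nat.mul_le_mul_left _ hc₁n
      _ = Q * (m * h) ^ 2 + m ^ 2 * n := by ring
      _ ≤ Q * (2 * n) ^ 2 + n * n := by
          refine Nat.add_le_add (Nat.mul_le_mul_left _ (Nat.pow_le_pow_left hmh2 2))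
            (Nat.mul_le_mul_right _ hmn)
      _ = (4 * Q + 1) * n * n := by ring
      _ ≤ L * n * n := by gcongr; omega
  · refine le_trans (Nat.le_of_mul_le_mul_right (c := n) ?_ hn) hLn
    calc t * c₁ * n = t * (c₁ * n) := by ring
      _ ≤ t * (Q * h ^ 2 + n) := Nat.mul_le_mul_left _ hc₁n
      _ = (Q * t) * h ^ 2 + t * n := by ring
      _ ≤ (5 * n) * h ^ 2 + n * n := by
          refine Nat.add_le_add (Nat.mul_le_mul_right _ ?_)
            (Nat.mul_le_mul_right _ (hts.trans hsn'))
          calc Q * t ≤ 5 * s * s := Nat.mul_le_mul hQs hts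
            _ = 5 * (s * s) := by ring
            _ ≤ 5 * n := Nat.mul_le_mul_left _ hsn
      _ = (5 * h ^ 2 + n) * n := by ring
  · omega
  · have hn0 : (0 : ℝ) < n := by exact_mod_cast hn
    have hn1 : (1 : ℝ) ≤ n := by exact_mod_cast hn
    have hβ0 : 0 < β := by linarith
    have hmβ : (t : ℝ) ≤ (m : ℝ) ^ β := by
      rw [ht, hm, Nat.cast_pow, Nat.cast_pow, ← Real.rpow_natCast, ← Real.rpow_natCast,
        ← Real.rpow_mul (by positivity), mul_comm, Real.rpow_mul (by positivity)]
      exact Real.rpow_le_rpow (by positivity) ht₀ (by positivity)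
    have hroot : n ≤ (2 * t₀ * t) ^ 2 := by
      have : s + 1 ≤ 2 * t₀ * t := by
        have : 2 * t₀ * t = 2 * (t * t₀) := by ring
        omega
      rw [sq]
      exact hns.le.trans (Nat.mul_le_mul this this)
    have hblock := sq_div_le_rpow hβ hn hm1 ht₀2.le hmβ hroot hmh2
    have hsqrt : (s : ℝ) ≤ (n : ℝ) ^ (1 - 1 / β) := by
      have h₁ : (s : ℝ) ≤ (n : ℝ) ^ (1 / 2 : ℝ) := by
        rw [← Real.sqrt_eq_rpow]
        exact Real.le_sqrt_of_sq_le (by rw [sq]; exact_mod_cast hsn)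
      refine h₁.trans (Real.rpow_le_rpow_of_exponent_le hn1 ?_)
      have : 1 / β ≤ 1 / 2 := one_div_le_one_div_of_le (by norm_num) hβ
      linarith
    have hdiv : (e : ℝ) ≤ 5 * ((h : ℝ) ^ 2 / n) := by
      rw [he]
      refine Nat.cast_div_le.trans (le_of_eq ?_)
      push_cast
      ring
    have hLs : L ≤ 23 * s + e := by omega
    calc (L : ℝ) ≤ 23 * s + e := by exact_mod_cast hLs
      _ ≤ 23 * (n : ℝ) ^ (1 - 1 / β) + 5 * (8 * t₀ * (n : ℝ) ^ (1 - 1 / β)) := by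
          linarith
      _ = _ := by ring

/-- Logarithms of polynomials are smaller than every power. -/
theorem exists_clog_le_rpow {η : ℝ} (hη : 0 < η) (a j : ℕ) :
    ∃ C : ℝ, 0 ≤ C ∧ ∀ n : ℕ, 1 ≤ n → ∀ x ≤ a * n ^ j, (Nat.clog 2 x : ℝ) ≤ C * (n : ℝ) ^ η := by
  have hloga : 0 ≤ Real.log ((a : ℝ) + 1) :=
    Real.log_nonneg (by linarith [Nat.cast_nonneg (α := ℝ) a])
  refine ⟨1 + 2 * (Real.log (a + 1) + j / η), by positivity, fun n hn x hx => ?_⟩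
  have hn1 : (1 : ℝ) ≤ n := by exact_mod_cast hn
  have hnη : 1 ≤ (n : ℝ) ^ η := Real.one_le_rpow hn1 hη.le
  rcases Nat.lt_or_ge 1 x with h1 | h1
  swap
  · rw [Nat.clog_of_right_le_one h1, Nat.cast_zero]
    positivity
  have hpow : 2 ^ (Nat.clog 2 x - 1) < x := Nat.pow_pred_clog_lt_self one_lt_two h1
  have hlog : ((Nat.clog 2 x - 1 : ℕ) : ℝ) * Real.log 2 ≤ Real.log x := by
    rw [← Real.log_pow]
    exact Real.log_le_log (by positivity) (by exact_mod_cast hpow.le)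
  have hx' : Real.log x ≤ Real.log (a + 1) + j * Real.log n := by
    rw [← Real.log_pow, ← Real.log_mul (by positivity) (by positivity)]
    refine Real.log_le_log (by exact_mod_cast (by omega : 0 < x)) ?_
    calc (x : ℝ) ≤ a * (n : ℝ) ^ j := by exact_mod_cast hx
      _ ≤ _ := by gcongr; linarith
  have hlogn : Real.log n ≤ (n : ℝ) ^ η / η := Real.log_le_rpow_div (by positivity) hη
  have hclog : (Nat.clog 2 x : ℝ) ≤ 1 + ((Nat.clog 2 x - 1 : ℕ) : ℝ) := by
    exact_mod_cast (by omega : Nat.clog 2 x ≤ 1 + (Nat.clog 2 x - 1))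
  have hhalf : ((Nat.clog 2 x - 1 : ℕ) : ℝ) ≤ 2 * Real.log x := by
    have h2 : (1 / 2 : ℝ) ≤ Real.log 2 := by linarith [Real.log_two_gt_d9]
    have : ((Nat.clog 2 x - 1 : ℕ) : ℝ) * (1 / 2) ≤ Real.log x :=
      (mul_le_mul_of_nonneg_left h2 (by positivity)).trans hlog
    linarith
  have hj : (j : ℝ) * Real.log n ≤ j * ((n : ℝ) ^ η / η) := by gcongr
  have hloga' : Real.log ((a : ℝ) + 1) ≤ Real.log (a + 1) * (n : ℝ) ^ η :=
    le_mul_of_one_le_right hloga hnη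
  calc (Nat.clog 2 x : ℝ) ≤ 1 + 2 * (Real.log (a + 1) + j * ((n : ℝ) ^ η / η)) := by linarith
    _ ≤ (n : ℝ) ^ η + 2 * (Real.log (a + 1) * (n : ℝ) ^ η + j * ((n : ℝ) ^ η / η)) := by linarith
    _ = _ := by ring

/-- The protocol for `n ≥ 2` nodes over `ZMod p`, for a tensor that is available modulo `p`. -/
theorem exists_protocol_of_prime {m₀ t₀ : ℕ} (hm₀ : 2 ≤ m₀) {β : ℝ} (hβ : 2 ≤ β)
    (ht₀ : (t₀ : ℝ) ≤ (m₀ : ℝ) ^ β) {p : ℕ} [Fact p.Prime] (hp2 : 2 < p)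
    (hT : HasMatMulTensor (ZMod p) m₀ t₀) {n B : ℕ} (hB : 1 ≤ B) (hn : 1 ≤ n) :
    ∃ P : CliqueProtocol n B (Set (Fin n)) (Set (Fin n) × Set (Fin n) × Set (Fin n)),
      (P.rounds : ℝ) ≤ 4 * Nat.clog 2 p + 48 * (Nat.clog 2 (2 * (Nat.sqrt n + 1)) *
        ((23 + 40 * t₀) * (n : ℝ) ^ (1 - 1 / β) * Nat.clog 2 p)) + 8 ∧
      ∀ G : SimpleGraph (Fin n), 1 - ((n + 1) * n : ℝ) / p ≤
        P.successProb (fun v => G.neighborSet v) fun out => ∀ v, out v = G.gallaiEdmonds := by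
  obtain ⟨m, t, h, c₁, c₂, L, hT', hmh, hc₁, hc₂, hqL, hmL, htL, hhL, hL⟩ :=
    exists_batch_parameters hm₀ hT hβ ht₀ hn
  have hF : Fintype.card (ZMod p) ≤ 2 ^ Nat.clog 2 p := by
    rw [ZMod.card]
    exact Nat.le_pow_clog one_lt_two p
  have h2 : (2 : ZMod p) ≠ 0 := by
    intro h0
    have : ((2 : ℕ) : ZMod p) = 0 := by exact_mod_cast h0
    rw [ZMod.natCast_eq_zero_iff] at this
    exact absurd (Nat.le_of_dvd two_pos this) (not_le.mpr hp2)
  have hns : n < (Nat.sqrt n + 1) * (Nat.sqrt n + 1) := Nat.lt_succ_sqrt n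
  obtain ⟨P, hP, hprob⟩ := exists_protocol_gallaiEdmonds hB hn h2 hF
    (q := 2 * (Nat.sqrt n + 1)) (R := 6 * (4 * (L * Nat.clog 2 p))) (by nlinarith)
    (fun K X Y hX hY => Evolves.mul_batch hB hn hF hT' hmh hc₁ hc₂ hqL hmL htL hhL K X Y hX hY)
  rw [ZMod.card] at hprob
  refine ⟨P, ?_, hprob⟩
  rw [hP]
  push_cast
  have h₁ : (Nat.clog 2 (2 * (Nat.sqrt n + 1)) : ℝ) * (L * Nat.clog 2 p) ≤
      Nat.clog 2 (2 * (Nat.sqrt n + 1)) *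
        ((23 + 40 * t₀) * (n : ℝ) ^ (1 - 1 / β) * Nat.clog 2 p) := by gcongr
  linarith

/-- Messages have `c * ⌈log₂ n⌉` bits, the input of node `v` is its set of neighbours, and with
probability at least `1 - n ^ (-k)` every node outputs the whole decomposition. -/
theorem theorem8 (ε : ℝ) (hε : 0 < ε) (c : ℕ) (hc : 1 ≤ c) (k : ℕ) :
    ∃ C : ℝ, ∀ n : ℕ, 1 ≤ n →
      ∃ P : CliqueProtocol n (c * Nat.clog 2 n) (Set (Fin n))
          (Set (Fin n) × Set (Fin n) × Set (Fin n)),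
        (P.rounds : ℝ) ≤ C * (n : ℝ) ^ (1 - 1 / matMulExponent ℚ + ε) ∧
        ∀ G : SimpleGraph (Fin n),
          1 - 1 / (n : ℝ) ^ k ≤
            P.successProb (fun v => G.neighborSet v)
              (fun out => ∀ v : Fin n, out v = G.gallaiEdmonds) := by
  have hω : 2 ≤ matMulExponent ℚ := two_le_matMulExponent ℚ
  obtain ⟨m₀, t₀, hm₀, hT, ht₀⟩ := exists_hasMatMulTensor_rank_le ℚ hε
  set ω := matMulExponent ℚ
  set β := ω + ε with hβdef
  have hβ : 2 ≤ β := by linarith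
  obtain ⟨D, hD, hTF⟩ := hT.exists_denominator
  obtain ⟨C₁, hC₁, hlog₁⟩ := exists_clog_le_rpow (show 0 < ε / 4 by positivity)
    (2 * (D.natAbs + 4)) (k + 2)
  obtain ⟨C₂, hC₂, hlog₂⟩ := exists_clog_le_rpow (show 0 < ε / 4 by positivity) 4 1
  refine ⟨4 * C₁ + 48 * (C₂ * ((23 + 40 * t₀) * C₁)) + 8, fun n hn => ?_⟩
  rcases Nat.lt_or_ge 1 n with hn1 | hn1
  swap
  -- A single node has messages of zero bits, so routing is unavailable, but the required
  -- probability is `1 - 1 = 0` and any protocol will do.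
  · obtain rfl : n = 1 := le_antisymm hn1 hn
    refine ⟨⟨Unit, inferInstance, inferInstance, Unit, 0, fun _ _ _ => (), fun _ _ _ _ _ => false,
      fun _ _ _ _ => (),
      fun _ _ => (⊥ : SimpleGraph (Fin 1)).gallaiEdmonds⟩, ?_, fun G => ?_⟩
    · rw [Nat.cast_zero]
      positivity
    · rw [Nat.cast_one, one_pow, div_one, sub_self]
      exact div_nonneg (Nat.cast_nonneg _) (Nat.cast_nonneg _)
  have hB : 1 ≤ c * Nat.clog 2 n := Nat.mul_pos hc (Nat.clog_pos one_lt_two hn1)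
  have hnpow : 1 ≤ n ^ (k + 2) := Nat.one_le_pow _ _ hn
  -- Bertrand's postulate. The prime exceeds `|D|`, so the tensor survives modulo `p`; it exceeds 2
  -- and is large enough for `(n + 1) n / p ≤ n ^ (-k)`, yet polynomial in `n`, so field elements
  -- take `O(log n)` bits.
  obtain ⟨p, hp, hNp, hpN⟩ := Nat.exists_prime_lt_and_le_two_mul
    ((D.natAbs + 4) * n ^ (k + 2)) (by positivity)
  have : Fact p.Prime := ⟨hp⟩
  have hDp : D.natAbs + 4 < p := (Nat.le_mul_of_pos_right _ hnpow).trans_lt hNp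
  have hDF : (D : ZMod p) ≠ 0 := by
    rw [Ne, ZMod.intCast_zmod_eq_zero_iff_dvd]
    intro h
    have := Nat.le_of_dvd (Int.natAbs_pos.mpr hD) (Int.natCast_dvd.mp h)
    omega
  obtain ⟨P, hP, hprob⟩ := exists_protocol_of_prime hm₀ hβ ht₀ (by omega) (hTF (ZMod p) hDF) hB hn
  have hn' : (1 : ℝ) ≤ n := by exact_mod_cast hn
  have hn0 : (0 : ℝ) < n := by linarith
  refine ⟨P, hP.trans ?_, fun G => le_trans ?_ (hprob G)⟩
  · have hb := hlog₁ n hn p (by rw [mul_assoc]; exact hpN)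
    have hq := hlog₂ n hn (2 * (Nat.sqrt n + 1)) (by
      have := Nat.sqrt_le_self n
      rw [pow_one]
      omega)
    set η := ε / 4 with hη
    -- As `ω * β ≥ 4`, replacing `ω` by `β = ω + ε` costs at most `ε / 4` in the exponent; the two
    -- logarithmic factors cost `ε / 4` each.
    have hexp : 1 - 1 / β + 2 * η ≤ 1 - 1 / ω + ε := by
      have h₁ : 1 / ω - 1 / β ≤ ε / 4 := by
        rw [div_sub_div _ _ (by linarith) (by linarith), div_le_iff₀ (by positivity)]
        have : 4 ≤ ω * β := by nlinarith
        nlinarith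
      linarith
    have hβ0 : 0 ≤ 1 - 1 / β := by
      have : 1 / β ≤ 1 := by
        rw [div_le_one (by linarith)]
        linarith
      linarith
    set E := (n : ℝ) ^ (1 - 1 / ω + ε)
    have hηE : (n : ℝ) ^ η ≤ E := Real.rpow_le_rpow_of_exponent_le hn' (by linarith)
    have hprodE : (n : ℝ) ^ η * ((n : ℝ) ^ (1 - 1 / β) * (n : ℝ) ^ η) ≤ E := by
      rw [← Real.rpow_add hn0, ← Real.rpow_add hn0]
      exact Real.rpow_le_rpow_of_exponent_le hn' (by linarith)
    have hE1 : 1 ≤ E := Real.one_le_rpow hn' (by linarith)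
    calc _ ≤ 4 * (C₁ * (n : ℝ) ^ η) + 48 * ((C₂ * (n : ℝ) ^ η) *
          ((23 + 40 * t₀) * (n : ℝ) ^ (1 - 1 / β) * (C₁ * (n : ℝ) ^ η))) + 8 := by gcongr
      _ = 4 * C₁ * (n : ℝ) ^ η + 48 * (C₂ * ((23 + 40 * t₀) * C₁)) *
          ((n : ℝ) ^ η * ((n : ℝ) ^ (1 - 1 / β) * (n : ℝ) ^ η)) + 8 := by ring
      _ ≤ 4 * C₁ * E + 48 * (C₂ * ((23 + 40 * t₀) * C₁)) * E + 8 * E := by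
          gcongr
          linarith
      _ = _ := by ring
  · have hp0 : (0 : ℝ) < p := by exact_mod_cast hp.pos
    have h₁ : (n + 1) * n * n ^ k ≤ p := by
      calc (n + 1) * n * n ^ k ≤ (4 * n) * n * n ^ k := by gcongr; omega
        _ = 4 * n ^ (k + 2) := by ring
        _ ≤ (D.natAbs + 4) * n ^ (k + 2) := Nat.mul_le_mul_right _ (by omega)
        _ ≤ p := hNp.le
    have h₂ : ((n + 1) * n : ℝ) / p ≤ 1 / (n : ℝ) ^ k := by
      rw [div_le_div_iff₀ hp0 (by positivity), one_mul]
      exact_mod_cast h₁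
    linarith
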